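/- Let $1\le p<\infty$, $\beta\in\mathbb R$ with $\beta\neq p$, and let $C_D, C_H\ge 0$ be constants. Then there is $\varepsilon>0$, depending only on $p,\beta,C_D,C_H$, such that the following holds. Let $X=(X,d,\mu)$ be a complete metric space with a Borel measure $\mu$ such that all closed balls $B(x,r)=\{y: d(x,y)\le r\}$, $r>0$, satisfy $0<\mu(B(x,r))<\infty$ and $\mu(B(x,2r))\le C_D\,\mu(B(x,r))$. Let $\Omega\subset X$ be an open set, with complement $\Omega^c=X\setminus\Omega$ and $d_\Omega(x)=\operatorname{dist}(x,\Omega^c)$, that admits a $(p,\beta)$-Hardy inequality with constant $C_H$, that is, $$\int_\Omega |u|^p\, d_\Omega^{\beta-p}\,d\mu\le C_H\int_\Omega g^p\, d_\Omega^{\beta}\,d\mu$$ for all Lipschitz functions $u$ with compact support in $\Omega$ and all upper gradients $g$ of $u$ (Borel functions $g\colon X\to[0,\infty]$ with $|u(y)-u(x)|\le\int_\gamma g\,ds$ for every compact rectifiable curve $\gamma$ with endpoints $x,y$). Then for every ball $B_0=B(x_0,R_0)$, with $2B_0=B(x_0,2R_0)$, either $$\operatorname{co\,dim}_H(2B_0\cap\Omega^c)<p-\beta-\varepsilon\quad\text{or}\quad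 \underline{\operatorname{co\,dim}}_A(B_0\cap\Omega^c)>p-\beta+\varepsilon .$$ Here, for $E\subset X$, both codimensions take values in $[0,\infty]$ (suprema over $q,t\ge0$, the supremum of the empty set being $0$): * $\operatorname{co\,dim}_H(E)=\sup\{q\ge 0: \mathcal H^{\mu,q}_R(E)=0 \text{ for all } 0<R<\infty\}$, where $\mathcal H^{\mu,q}_R(E)$ is the infimum of $\sum_k \operatorname{rad}(B_k)^{-q}\mu(B_k)$ over all countable covers of $E$ by balls $B_k$ of radius at most $R$. * $\underline{\operatorname{co\,dim}}_A(E)$ is the supremum of all $t\ge0$ for which there is $C\ge1$ such that $\mu(E_r\cap B(x,R))/\mu(B(x,R))\le C(r/R)^t$ for all $x\in E$ and all $0<r<R<\operatorname{diam}(E)$, where $E_r=\{y:\operatorname{dist}(y,E)<r\}$; if $E$ is a single point, the range of radii is $0<r<R\le1$ instead. -/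

import Mathlib

open MeasureTheory Metric Set
open scoped NNReal ENNReal

/-- `μ` gives every (closed) ball of positive radius positive finite measure, and it is doubling with
constant `C`. -/
structure IsDoublingWith {X : Type*} [MetricSpace X] [MeasurableSpace X]
    (μ : Measure X) (C : ℝ≥0) : Prop where
  measure_pos : ∀ (x : X) (r : ℝ), 0 < r → 0 < μ (closedBall x r)
  measure_lt_top : ∀ (x : X) (r : ℝ), 0 < r → μ (closedBall x r) < ∞
  doubling : ∀ (x : X) (r : ℝ), 0 < r → μ (closedBall x (2 * r)) ≤ C * μ (closedBall x r)

/-- `g : X → [0,∞]` is an upper gradient of `f : X → ℝ`: it is Borel, and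
`|f y - f x| ≤ ∫_γ g ds` for every compact rectifiable curve `γ` with endpoints `x`, `y`.
The integral `∫_γ g ds` is by definition the integral of `g` along the arc-length parametrization
of `γ`, and each compact rectifiable curve has one (with the same endpoints); so the
curves are taken parametrized by arc length, on an arbitrary compact interval `[a, b]`. -/
def IsUpperGradient {X : Type*} [MetricSpace X] [MeasurableSpace X]
    (g : X → ℝ≥0∞) (f : X → ℝ) : Prop :=
  Measurable g ∧
    ∀ (γ : ℝ → X) (a b : ℝ), a ≤ b → HasUnitSpeedOn γ (Icc a b) →
      ENNReal.ofReal |f (γ b) - f (γ a)| ≤ ∫⁻ t in Icc a b, g (γ t)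

/-- `Ω` admits a `(p, β)`-Hardy inequality with constant `C`. The test functions, Lipschitz with
compact support in `Ω`, are extended by zero to `X`; `infDist x Ωᶜ` is the distance to the
complement. -/
def AdmitsHardyWith {X : Type*} [MetricSpace X] [MeasurableSpace X]
    (μ : Measure X) (Ω : Set X) (p β : ℝ) (C : ℝ≥0) : Prop :=
  ∀ u : X → ℝ, (∃ L : ℝ≥0, LipschitzWith L u) → HasCompactSupport u → tsupport u ⊆ Ω →
    ∀ g : X → ℝ≥0∞, IsUpperGradient g u →
      ∫⁻ x in Ω, ENNReal.ofReal (|u x| ^ p * infDist x Ωᶜ ^ (β - p)) ∂μ ≤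
        C * ∫⁻ x in Ω, g x ^ p * ENNReal.ofReal (infDist x Ωᶜ ^ β) ∂μ

/-- The Hausdorff content of codimension `q` at scale `R`: the infimum of
`∑ rad(B)^{-q} μ(B)` over countable (possibly finite or empty) covers of `E` by balls of radius
at most `R`. A ball is given by its centre and its radius. -/
noncomputable def hausdorffCocontent {X : Type*} [MetricSpace X] [MeasurableSpace X]
    (μ : Measure X) (R q : ℝ) (E : Set X) : ℝ≥0∞ :=
  ⨅ (F : Set (X × ℝ)) (_ : F.Countable) (_ : ∀ b ∈ F, 0 < b.2 ∧ b.2 ≤ R)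
    (_ : E ⊆ ⋃ b ∈ F, closedBall b.1 b.2),
    ∑' b : F, ENNReal.ofReal (b.1.2 ^ (-q)) * μ (closedBall b.1.1 b.1.2)

/-- The Hausdorff codimension, with values in `[0,∞]`: the supremum of the `q ≥ 0` such that the
content of codimension `q` vanishes. For a doubling measure the vanishing at one scale
`0 < R < ∞` is equivalent to the vanishing at all of them. If `μ E > 0` then
no `q ≥ 0` qualifies and the value is `0`. -/
noncomputable def codimH {X : Type*} [MetricSpace X] [MeasurableSpace X]
    (μ : Measure X) (E : Set X) : ℝ≥0∞ :=
  ⨆ (q : ℝ≥0) (_ : ∀ R : ℝ, 0 < R → hausdorffCocontent μ R q E = 0), (q : ℝ≥0∞)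

/-- The lower Assouad codimension, with values in `[0,∞]`: the supremum of the `t ≥ 0` such that,
for some `C ≥ 1`, `μ(E_r ∩ B(x,R)) / μ(B(x,R)) ≤ C (r/R)^t` for all `x ∈ E` and
`0 < r < R < diam E`. If `E` is a single point that range is empty, and the radii
`0 < r < R ≤ 1` are used. Here `E_r` is the open `r`-neighbourhood. -/
noncomputable def lcodimA {X : Type*} [MetricSpace X] [MeasurableSpace X]
    (μ : Measure X) (E : Set X) : ℝ≥0∞ :=
  ⨆ (t : ℝ≥0) (_ : ∃ C : ℝ, 1 ≤ C ∧ ∀ x ∈ E, ∀ r R : ℝ, 0 < r → r < R →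
      (ENNReal.ofReal R < ediam E ∨ (E.Subsingleton ∧ R ≤ 1)) →
      μ (thickening r E ∩ closedBall x R) / μ (closedBall x R) ≤
        ENNReal.ofReal (C * (r / R) ^ (t : ℝ))), (t : ℝ≥0∞)

/-! Let `β < p` and suppose that the Hausdorff codimension of `2B₀ ∩ Ωᶜ` is at least `p - β - ε`.
The Hardy inequality is tested with `u = θ ^ (n + 1) * F(d_Ω)`, where `F = peak δ H` and `θ` is a
minimum of cutoffs. Since `|F'(s)| ≤ δ F(s) / s`, the derivative of `F` produces only a multiple
`C_H 2^p δ^p ≤ 1/4` of the left side, which is absorbed. This room for a small `δ` is the source of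
the gain in both exponents: `F` is comparable to `s ^ (-δ)` at distances at least `a`, which raises
the exponent there to `t = p - β + δ p`, while `F ≤ s ^ δ / H` near the boundary lowers the exponent
needed there to `p - β - δ p`.

The function `θ` vanishes off a ball of radius `r₁ + r` and near finitely many small balls covering
`Ωᶜ` in it. The outer cutoff costs a multiple of `r ^ (-t) μ(ball)`. The covering balls cost a
multiple of `H ^ (-p) ∑ rad ^ (-(p - β - δ p)) μ(4B)`, and as the content of codimension `p - β - δ
p` vanishes, a cover exists for which this is no larger than the outer cost. Hence the layer `a ≤
d_Ω < s` has measure at most `const * (s / r) ^ t μ(ball)` with a constant independent of `a`.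
Letting `a → 0` bounds neighbourhoods of `Ωᶜ`, which is null in the ball, and so the Assouad
codimension is at least `t`.

The absorption is `lintegral_pow_mul_peak_le`; the cutoffs enter in `lintegral_inf_cutoff_le`;
`exists_finite_cover` supplies the balls; `measure_layer_le` combines them. -/

section
open Filter Topology

/-! ### Upper gradients of Lipschitz functions. -/

theorem HasUnitSpeedOn.lipschitzOnWith {X : Type*} [MetricSpace X] {γ : ℝ → X} {s : Set ℝ}
    (h : HasUnitSpeedOn γ s) : LipschitzOnWith 1 γ s := by
  have key : ∀ x ∈ s, ∀ y ∈ s, x ≤ y → edist (γ x) (γ y) ≤ edist x y := by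
    intro x hx y hy hxy
    have h1 := h hx hy
    have h2 : edist (γ x) (γ y) ≤ eVariationOn γ (s ∩ Icc x y) :=
      eVariationOn.edist_le γ ⟨hx, le_refl x, hxy⟩ ⟨hy, hxy, le_refl y⟩
    rw [h1] at h2
    refine h2.trans (le_of_eq ?_)
    rw [edist_dist, Real.dist_eq, abs_sub_comm, abs_of_nonneg (sub_nonneg.2 hxy)]
    simp
  intro x hx y hy
  rw [ENNReal.coe_one, one_mul]
  rcases le_total x y with hxy | hxy
  · exact key x hx y hy hxy
  · rw [edist_comm (γ x), edist_comm x]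
    exact key y hy x hx hxy

/-- A Lipschitz function has as upper gradient any Borel function that dominates the speed of the
function along almost every point of every `1`-Lipschitz curve. -/
theorem isUpperGradient_of_deriv_le {X : Type*} [MetricSpace X] [MeasurableSpace X]
    {g : X → ℝ≥0∞} {u : X → ℝ} (hg : Measurable g) {L : ℝ≥0} (hu : LipschitzWith L u)
    (h : ∀ γ : ℝ → X, LipschitzWith 1 γ →
      ∀ᵐ t, ENNReal.ofReal |deriv (u ∘ γ) t| ≤ g (γ t)) :
    IsUpperGradient g u := by
  refine ⟨hg, fun γ₀ a b hab hγ₀ => ?_⟩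
  -- The curve is extended by constants beyond `[a, b]`, so that it is `1`-Lipschitz on the whole
  -- line and the hypothesis `h` applies.
  set γ : ℝ → X := IccExtend hab ((Icc a b).domRestrict γ₀) with hγdef
  have hγ : LipschitzWith 1 γ := by
    have h1 : LipschitzWith 1 ((Icc a b).domRestrict γ₀) := hγ₀.lipschitzOnWith.to_restrict
    have := h1.comp (LipschitzWith.projIcc hab)
    rwa [one_mul] at this
  have heq : ∀ t ∈ Icc a b, γ t = γ₀ t := fun t ht => by
    rw [hγdef, IccExtend_of_mem _ _ ht, domRestrict_apply]
  have hL : LipschitzWith L (u ∘ γ) := by simpa using hu.comp hγ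
  have hac : AbsolutelyContinuousOnInterval (u ∘ γ) a b :=
    (hL.lipschitzOnWith (s := uIcc a b)).absolutelyContinuousOnInterval
  have hftc := hac.integral_deriv_eq_sub
  rw [← heq a ⟨le_rfl, hab⟩, ← heq b ⟨hab, le_rfl⟩]
  have e1 : u (γ b) - u (γ a) = ∫ t in Ioc a b, deriv (u ∘ γ) t := by
    rw [← intervalIntegral.integral_of_le hab, hftc]; rfl
  rw [e1]
  calc ENNReal.ofReal |∫ t in Ioc a b, deriv (u ∘ γ) t|
      = ‖∫ t in Ioc a b, deriv (u ∘ γ) t‖ₑ := by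
        rw [← Real.norm_eq_abs, ofReal_norm]
    _ ≤ ∫⁻ t in Ioc a b, ‖deriv (u ∘ γ) t‖ₑ := enorm_integral_le_lintegral_enorm _
    _ ≤ ∫⁻ t in Icc a b, ‖deriv (u ∘ γ) t‖ₑ := lintegral_mono_set Ioc_subset_Icc_self
    _ ≤ ∫⁻ t in Icc a b, g (γ t) := by
        refine lintegral_mono_ae (ae_restrict_of_ae ?_)
        filter_upwards [h γ hγ] with t ht
        rwa [← ofReal_norm, Real.norm_eq_abs]
    _ = ∫⁻ t in Icc a b, g (γ₀ t) := by
        refine setLIntegral_congr_fun measurableSet_Icc fun t ht => ?_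
        simp only [heq t ht]

/-! ### The radial profile `peak`. -/

/-- The function `s ↦ s ^ δ / (H + s ^ (2 δ))`, which behaves like `s ^ (-δ)` for `s ^ (2 δ) ≥ H`
and like `s ^ δ / H` for small `s`. -/
noncomputable def peak (δ H s : ℝ) : ℝ := s ^ δ / (H + (s ^ δ) ^ 2)

section peak
variable {δ H s : ℝ}

theorem peak_nonneg (hH : 0 < H) (hs : 0 ≤ s) : 0 ≤ peak δ H s := by
  unfold peak; positivity

theorem peak_le_rpow_neg (hH : 0 < H) (hs : 0 < s) : peak δ H s ≤ s ^ (-δ) := by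
  unfold peak
  have : 0 < s ^ δ := by positivity
  rw [Real.rpow_neg hs.le, div_le_iff₀ (by positivity), inv_mul_eq_div, le_div_iff₀ this]
  nlinarith

theorem peak_le_rpow_div (hH : 0 < H) (hs : 0 < s) : peak δ H s ≤ s ^ δ / H := by
  unfold peak
  have : 0 < s ^ δ := by positivity
  gcongr
  nlinarith [sq_nonneg (s ^ δ)]

theorem le_peak (hH : 0 < H) (hs : 0 < s) (h : H ≤ (s ^ δ) ^ 2) :
    s ^ (-δ) / 2 ≤ peak δ H s := by
  unfold peak
  have : 0 < s ^ δ := by positivity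
  rw [Real.rpow_neg hs.le, le_div_iff₀ (by positivity)]
  field_simp
  nlinarith

/-- With `q = s ^ δ`, the logarithmic derivative is `(δ / s) (H - q²) / (H + q²)`, and the last
factor lies in `[-1, 1]`. So both power regimes, and the transition between them, obey the same
bound. -/
theorem exists_hasDerivAt_peak (hδ : 0 ≤ δ) (hH : 0 < H) (hs : 0 < s) :
    ∃ e, HasDerivAt (peak δ H) e s ∧ |e| ≤ δ * peak δ H s / s := by
  have hq : 0 < s ^ δ := by positivity
  have h1 : HasDerivAt (fun s : ℝ => s ^ δ) (δ * s ^ (δ - 1)) s :=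
    Real.hasDerivAt_rpow_const (Or.inl hs.ne')
  have h2 : HasDerivAt (peak δ H) ((δ * s ^ (δ - 1) * (H + (s ^ δ) ^ 2) -
      s ^ δ * (((2 : ℕ) : ℝ) * (s ^ δ) ^ (2 - 1) * (δ * s ^ (δ - 1)))) / (H + (s ^ δ) ^ 2) ^ 2) s :=
    h1.fun_div ((h1.fun_pow 2).const_add H) (by positivity)
  refine ⟨_, h2, ?_⟩
  rw [Real.rpow_sub_one hs.ne']
  unfold peak
  set q := s ^ δ
  have e1 : (δ * (q / s) * (H + q ^ 2) - q * (((2 : ℕ) : ℝ) * q ^ (2 - 1) * (δ * (q / s)))) /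
      (H + q ^ 2) ^ 2 = (δ * (q / (H + q ^ 2)) / s) * ((H - q ^ 2) / (H + q ^ 2)) := by
    field_simp
    push_cast
    ring
  rw [e1, abs_mul, abs_of_nonneg (by positivity)]
  refine mul_le_of_le_one_right (by positivity) ?_
  rw [abs_div, abs_of_pos (show 0 < H + q ^ 2 by positivity), div_le_one (by positivity), abs_le]
  constructor <;> nlinarith [sq_nonneg q]

theorem measurable_peak : Measurable (peak δ H) := by
  unfold peak; fun_prop

theorem lipschitzOnWith_peak (hδ : 0 ≤ δ) (hH : 0 < H) {a : ℝ} (ha : 0 < a) :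
    ∃ K, LipschitzOnWith K (peak δ H) (Ici a) := by
  refine ⟨(δ * a ^ (-δ) / a).toNNReal, ?_⟩
  refine Convex.lipschitzOnWith_of_nnnorm_deriv_le (𝕜 := ℝ) (fun x hx => ?_) (fun x hx => ?_)
    (convex_Ici a)
  · have hx0 : 0 < x := ha.trans_le hx
    obtain ⟨e, he, -⟩ := exists_hasDerivAt_peak hδ hH hx0
    exact he.differentiableAt
  · have hx0 : 0 < x := ha.trans_le hx
    obtain ⟨e, he, hle⟩ := exists_hasDerivAt_peak hδ hH hx0
    rw [he.deriv]
    rw [← NNReal.coe_le_coe, coe_nnnorm, Real.norm_eq_abs]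
    refine (hle.trans ?_).trans (Real.le_coe_toNNReal _)
    have hp := peak_le_rpow_neg (δ := δ) hH hx0
    have h3 : x ^ (-δ) ≤ a ^ (-δ) := Real.rpow_le_rpow_of_nonpos ha hx (by linarith)
    have h4 : a ≤ x := hx
    have : 0 ≤ a ^ (-δ) := by positivity
    have := hp.trans h3
    gcongr
end peak

/-! ### The test functions and their upper gradients. -/

theorem LipschitzWith.mul_of_bounded {X : Type*} [MetricSpace X] {f g : X → ℝ} {K L : ℝ≥0}
    (hf : LipschitzWith K f) (hg : LipschitzWith L g) {A B : ℝ≥0}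
    (hA : ∀ x, |f x| ≤ A) (hB : ∀ x, |g x| ≤ B) :
    LipschitzWith (K * B + A * L) (fun x => f x * g x) := by
  refine LipschitzWith.of_dist_le_mul fun x y => ?_
  have h1 := hf.dist_le_mul x y
  have h2 := hg.dist_le_mul x y
  rw [Real.dist_eq] at *
  have e : f x * g x - f y * g y = (f x - f y) * g x + f y * (g x - g y) := by ring
  rw [e]
  refine (abs_add_le _ _).trans ?_
  rw [abs_mul, abs_mul]
  have := hB x
  have := hA y
  push_cast
  calc _ ≤ K * dist x y * B + A * (L * dist x y) := by gcongr
    _ = _ := by ring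

theorem LipschitzWith.pow_of_abs_le_one {X : Type*} [MetricSpace X] {f : X → ℝ} {K : ℝ≥0}
    (hf : LipschitzWith K f) (hA : ∀ x, |f x| ≤ 1) (n : ℕ) :
    ∃ L, LipschitzWith L (fun x => f x ^ n) := by
  induction n with
  | zero => exact ⟨0, by simp⟩
  | succ n ih =>
    obtain ⟨L, hL⟩ := ih
    simp only [pow_succ]
    refine ⟨_, hL.mul_of_bounded hf (A := 1) (B := 1) (fun x => ?_) hA⟩
    simp [abs_pow, pow_le_one₀ (abs_nonneg _) (hA x)]

theorem abs_deriv_comp_le_of_eventually_le {X : Type*} [MetricSpace X] {γ : ℝ → X}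
    (hγ : LipschitzWith 1 γ) {f : X → ℝ} {t c : ℝ} (hc : 0 ≤ c)
    (h : ∀ᶠ y in 𝓝 (γ t), |f y - f (γ t)| ≤ c * dist y (γ t)) : |deriv (f ∘ γ) t| ≤ c := by
  rw [← Real.norm_eq_abs]
  refine norm_deriv_le_of_lip' hc ?_
  filter_upwards [hγ.continuous.continuousAt.eventually h] with s hs
  refine hs.trans ?_
  have := hγ.dist_le_mul s t
  rw [Real.norm_eq_abs, ← Real.dist_eq]
  have h1 : dist (γ s) (γ t) ≤ dist s t := by simpa using this
  gcongr

/-- The test function `θ ^ (n + 1) * F(d_Ω)` is Lipschitz if `θ` has compact support in `Ω`. -/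
theorem lipschitzWith_pow_mul_peak {X : Type*} [MetricSpace X] {Ω : Set X} (hΩ : IsOpen Ω)
    (hne : Ωᶜ.Nonempty) {δ H : ℝ} (hδ : 0 ≤ δ) (hH : 0 < H) {θ : X → ℝ} {L : ℝ≥0}
    (hθL : LipschitzWith L θ) (hθ0 : ∀ x, 0 ≤ θ x) (hθ1 : ∀ x, θ x ≤ 1) (hθc : HasCompactSupport θ)
    (hθΩ : tsupport θ ⊆ Ω) (n : ℕ) :
    ∃ K, LipschitzWith K fun x => θ x ^ (n + 1) * peak δ H (infDist x Ωᶜ) := by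
  have hdpos : ∀ x ∈ Ω, 0 < infDist x Ωᶜ := fun x hx =>
    (hΩ.isClosed_compl.notMem_iff_infDist_pos hne).1 (by simpa using hx)
  obtain ⟨a, ha, had⟩ : ∃ a > 0, ∀ x ∈ tsupport θ, a ≤ infDist x Ωᶜ := by
    rcases (tsupport θ).eq_empty_or_nonempty with h | h
    · exact ⟨1, one_pos, by simp [h]⟩
    · obtain ⟨x, hx, hmin⟩ := hθc.isCompact.exists_isMinOn h
        (continuous_infDist_pt Ωᶜ).continuousOn
      exact ⟨_, hdpos x (hθΩ hx), hmin⟩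
  have habs : ∀ x, |θ x| ≤ 1 := fun x => by rw [abs_of_nonneg (hθ0 x)]; exact hθ1 x
  obtain ⟨K, hK⟩ := hθL.pow_of_abs_le_one habs (n + 1)
  obtain ⟨M, hM⟩ := lipschitzOnWith_peak hδ hH ha
  -- `peak` is controlled only away from `0`. Truncating the distance from below at `a` does not
  -- change the product, since `θ` vanishes wherever the truncation is active.
  have hmax : LipschitzWith 1 fun x => max (infDist x Ωᶜ) a := (lipschitz_infDist_pt _).max_const a
  have hpk : LipschitzWith M fun x => peak δ H (max (infDist x Ωᶜ) a) := by
    refine LipschitzWith.of_dist_le_mul fun x y => ?_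
    refine (hM.dist_le_mul _ (mem_Ici.2 (le_max_right _ _)) _ (mem_Ici.2 (le_max_right _ _))).trans ?_
    have := hmax.dist_le_mul x y
    rw [NNReal.coe_one, one_mul] at this
    gcongr
  have hbd : ∀ x, |peak δ H (max (infDist x Ωᶜ) a)| ≤ (a ^ (-δ)).toNNReal := fun x => by
    have h0 : 0 < max (infDist x Ωᶜ) a := lt_max_of_lt_right ha
    rw [abs_of_nonneg (peak_nonneg hH h0.le)]
    refine ((peak_le_rpow_neg hH h0).trans ?_).trans (Real.le_coe_toNNReal _)
    exact Real.rpow_le_rpow_of_nonpos ha (le_max_right _ _) (by linarith)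
  have hprod := hK.mul_of_bounded hpk (A := 1) (fun x => by
    rw [abs_pow]; exact pow_le_one₀ (abs_nonneg _) (habs x)) hbd
  have heq : (fun x => θ x ^ (n + 1) * peak δ H (infDist x Ωᶜ)) =
      fun x => θ x ^ (n + 1) * peak δ H (max (infDist x Ωᶜ) a) := by
    funext x
    by_cases hx : x ∈ tsupport θ
    · rw [max_eq_left (had x hx)]
    · rw [image_eq_zero_of_notMem_tsupport hx]; simp
  rw [heq]
  exact ⟨_, hprod⟩

/-- The product rule along curves. A pointwise bound `G` replaces the global Lipschitz constant of
`θ`, so that the second term can vanish where `θ` is locally constant. -/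
theorem isUpperGradient_pow_mul_peak {X : Type*} [MetricSpace X] [MeasurableSpace X] [BorelSpace X]
    {Ω : Set X} (hΩ : IsOpen Ω) (hne : Ωᶜ.Nonempty) {δ H : ℝ} (hδ : 0 ≤ δ) (hH : 0 < H)
    {θ G : X → ℝ} {L : ℝ≥0} (hθL : LipschitzWith L θ) (hθ0 : ∀ x, 0 ≤ θ x) (hθ1 : ∀ x, θ x ≤ 1)
    (hθc : HasCompactSupport θ) (hθΩ : tsupport θ ⊆ Ω) (hGm : Measurable G) (hG0 : ∀ x, 0 ≤ G x)
    (hG : ∀ x, ∀ᶠ y in 𝓝 x, |θ y - θ x| ≤ G x * dist y x) (n : ℕ) :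
    IsUpperGradient
      (fun x => ENNReal.ofReal (θ x ^ (n + 1) * (δ * peak δ H (infDist x Ωᶜ) / infDist x Ωᶜ) +
        (n + 1) * (θ x ^ n * peak δ H (infDist x Ωᶜ) * G x)))
      (fun x => θ x ^ (n + 1) * peak δ H (infDist x Ωᶜ)) := by
  obtain ⟨K, hK⟩ := lipschitzWith_pow_mul_peak hΩ hne hδ hH hθL hθ0 hθ1 hθc hθΩ n
  have hθm : Measurable θ := hθL.continuous.measurable
  have hdm : Measurable fun x => infDist x Ωᶜ := (continuous_infDist_pt _).measurable
  have hpm : Measurable fun x => peak δ H (infDist x Ωᶜ) := measurable_peak.comp hdm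
  refine isUpperGradient_of_deriv_le (by fun_prop) hK fun γ hγ => ?_
  have hdL : LipschitzWith (1 * 1) ((fun x => infDist x Ωᶜ) ∘ γ) :=
    (lipschitz_infDist_pt Ωᶜ).comp hγ
  filter_upwards [(hθL.comp hγ).ae_differentiableAt_real, hdL.ae_differentiableAt_real] with t h1 h2
  by_cases hx : γ t ∈ Ω
  · refine ENNReal.ofReal_le_ofReal ?_
    have hd : 0 < infDist (γ t) Ωᶜ :=
      (hΩ.isClosed_compl.notMem_iff_infDist_pos hne).1 (by simpa using hx)
    obtain ⟨e, he, hele⟩ := exists_hasDerivAt_peak hδ hH hd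
    have hθ' : |deriv (θ ∘ γ) t| ≤ G (γ t) :=
      abs_deriv_comp_le_of_eventually_le hγ (hG0 _) (hG _)
    have hd' : |deriv ((fun x => infDist x Ωᶜ) ∘ γ) t| ≤ 1 := by
      have := norm_deriv_le_of_lipschitz hdL (x₀ := t)
      simpa using this
    have hder := (h1.hasDerivAt.fun_pow (n + 1)).fun_mul (HasDerivAt.comp t he h2.hasDerivAt)
    have hder' : deriv ((fun x => θ x ^ (n + 1) * peak δ H (infDist x Ωᶜ)) ∘ γ) t = _ :=
      hder.deriv
    rw [hder']
    have hF := peak_nonneg (δ := δ) hH hd.le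
    have hθt := hθ0 (γ t)
    simp only [Function.comp_apply, Nat.add_sub_cancel]
    refine (abs_add_le _ _).trans ?_
    simp only [abs_mul, abs_pow]
    rw [abs_of_nonneg hθt, abs_of_nonneg hF, add_comm, Nat.abs_cast]
    push_cast
    refine add_le_add ?_ ?_
    · refine mul_le_mul_of_nonneg_left ?_ (by positivity)
      calc |e| * _ ≤ (δ * peak δ H (infDist (γ t) Ωᶜ) / infDist (γ t) Ωᶜ) * 1 := by
            refine mul_le_mul hele hd' (abs_nonneg _) (by positivity)
        _ = _ := mul_one _
    · calc _ ≤ ((n : ℝ) + 1) * θ (γ t) ^ n * G (γ t) * peak δ H (infDist (γ t) Ωᶜ) := by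
            refine mul_le_mul_of_nonneg_right ?_ hF
            exact mul_le_mul_of_nonneg_left hθ' (by positivity)
        _ = _ := by ring
  · have h0 : θ =ᶠ[𝓝 (γ t)] 0 := notMem_tsupport_iff_eventuallyEq.1 fun h => hx (hθΩ h)
    have h3 : ((fun x => θ x ^ (n + 1) * peak δ H (infDist x Ωᶜ)) ∘ γ) =ᶠ[𝓝 t] fun _ => 0 := by
      filter_upwards [hγ.continuous.continuousAt.eventually h0] with s hs
      simp only [Function.comp_apply]
      rw [hs]; simp
    rw [h3.deriv_eq]
    simp

/-! ### Absorption in the Hardy inequality. -/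

theorem add_rpow_le_two_rpow_mul {a b p : ℝ} (ha : 0 ≤ a) (hb : 0 ≤ b) (hp : 0 ≤ p) :
    (a + b) ^ p ≤ 2 ^ p * (a ^ p + b ^ p) := by
  have h1 : (max a b) ^ p ≤ a ^ p + b ^ p := by
    rcases max_cases a b with ⟨h, -⟩ | ⟨h, -⟩ <;> rw [h]
    · exact le_add_of_nonneg_right (by positivity)
    · exact le_add_of_nonneg_left (by positivity)
  calc (a + b) ^ p ≤ (2 * max a b) ^ p := by
        refine Real.rpow_le_rpow (by positivity) ?_ hp
        linarith [le_max_left a b, le_max_right a b]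
    _ = 2 ^ p * max a b ^ p := Real.mul_rpow (by norm_num) (le_max_of_le_left ha)
    _ ≤ _ := by gcongr

/-- The Hardy inequality tested with `θ ^ (n + 1) * F(d_Ω)`, after absorption. -/
theorem AdmitsHardyWith.lintegral_pow_mul_peak_le {X : Type*} [MetricSpace X] [MeasurableSpace X]
    [BorelSpace X] {μ : Measure X} {Ω : Set X} {p β : ℝ} {C : ℝ≥0}
    (hHardy : AdmitsHardyWith μ Ω p β C) (hp : 1 ≤ p)
    (hΩ : IsOpen Ω) (hne : Ωᶜ.Nonempty) {δ H : ℝ} (hδ : 0 ≤ δ) (hH : 0 < H)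
    {θ G : X → ℝ} {L : ℝ≥0} (hθL : LipschitzWith L θ) (hθ0 : ∀ x, 0 ≤ θ x) (hθ1 : ∀ x, θ x ≤ 1)
    (hθc : HasCompactSupport θ) (hθΩ : tsupport θ ⊆ Ω) (hμ : μ (tsupport θ) ≠ ∞)
    (hGm : Measurable G) (hG0 : ∀ x, 0 ≤ G x)
    (hG : ∀ x, ∀ᶠ y in 𝓝 x, |θ y - θ x| ≤ G x * dist y x) (n : ℕ) {τ : ℝ} (hτ : 0 ≤ τ)
    (hδC : C * (2 ^ p * δ ^ p) ≤ 1 / 4) (hτC : C * (2 ^ p * ((n + 1) ^ p * τ ^ p)) ≤ 1 / 4)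
    {N : X → ℝ≥0∞} (hNm : Measurable N)
    (hN : ∀ x ∈ Ω, ENNReal.ofReal ((θ x ^ n * peak δ H (infDist x Ωᶜ) * G x) ^ p *
        infDist x Ωᶜ ^ β) ≤
      ENNReal.ofReal (τ ^ p * ((θ x ^ (n + 1) * peak δ H (infDist x Ωᶜ)) ^ p *
        infDist x Ωᶜ ^ (β - p))) + N x) :
    ∫⁻ x in Ω, ENNReal.ofReal ((θ x ^ (n + 1) * peak δ H (infDist x Ωᶜ)) ^ p *
        infDist x Ωᶜ ^ (β - p)) ∂μ ≤
      2 * C * ENNReal.ofReal (2 ^ p * (n + 1) ^ p) * ∫⁻ x in Ω, N x ∂μ := by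
  have hp0 : 0 < p := by linarith
  have hdpos : ∀ x ∈ Ω, 0 < infDist x Ωᶜ := fun x hx =>
    (hΩ.isClosed_compl.notMem_iff_infDist_pos hne).1 (by simpa using hx)
  set u : X → ℝ := fun x => θ x ^ (n + 1) * peak δ H (infDist x Ωᶜ) with hu
  have hu0 : ∀ x, 0 ≤ u x := fun x => mul_nonneg (pow_nonneg (hθ0 x) _) (peak_nonneg hH infDist_nonneg)
  have hLip := lipschitzWith_pow_mul_peak hΩ hne hδ hH hθL hθ0 hθ1 hθc hθΩ n
  have hug := isUpperGradient_pow_mul_peak hΩ hne hδ hH hθL hθ0 hθ1 hθc hθΩ hGm hG0 hG n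
  have hsupp : tsupport u ⊆ tsupport θ := by
    refine closure_mono fun x hx => ?_
    contrapose! hx
    simp [hu, Function.notMem_support.1 hx]
  have huc : HasCompactSupport u := hθc.of_isClosed_subset (isClosed_tsupport u) hsupp
  have hdm : Measurable fun x => infDist x Ωᶜ := (continuous_infDist_pt _).measurable
  have hum : Measurable u := hLip.choose_spec.continuous.measurable
  set w : X → ℝ := fun x => u x ^ p * infDist x Ωᶜ ^ (β - p) with hw
  have hwm : Measurable w := by fun_prop
  have hw0 : ∀ x, 0 ≤ w x := fun x => mul_nonneg (Real.rpow_nonneg (hu0 x) _)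
    (Real.rpow_nonneg infDist_nonneg _)
  set W : ℝ≥0∞ := ∫⁻ x in Ω, ENNReal.ofReal (w x) ∂μ with hW
  -- Absorption subtracts `W / 2` from both sides, which requires `W` to be finite: the integrand is
  -- bounded on the compact support, where `d_Ω` stays away from `0`.
  have hWfin : W ≠ ∞ := by
    have hcont : ContinuousOn w (tsupport θ) := by
      refine ContinuousOn.mul ?_ ?_
      · exact (hLip.choose_spec.continuous.rpow_const fun _ => Or.inr hp0.le).continuousOn
      · exact (continuous_infDist_pt _).continuousOn.rpow_const fun x hx =>
          Or.inl (hdpos x (hθΩ hx)).ne'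
    obtain ⟨c, hc⟩ := hθc.isCompact.bddAbove_image hcont
    have : W ≤ ∫⁻ x in tsupport θ, ENNReal.ofReal c ∂μ := by
      refine (lintegral_mono' Measure.restrict_le_self le_rfl).trans ?_
      rw [← lintegral_indicator (isClosed_tsupport θ).measurableSet]
      refine lintegral_mono fun x => ?_
      by_cases hx : x ∈ tsupport θ
      · rw [indicator_of_mem hx]
        exact ENNReal.ofReal_le_ofReal (hc (mem_image_of_mem _ hx))
      · have : θ x = 0 := image_eq_zero_of_notMem_tsupport hx
        simp [hw, hu, this, Real.zero_rpow hp0.ne']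
    refine ne_top_of_le_ne_top ?_ this
    rw [setLIntegral_const]
    exact ENNReal.mul_ne_top ENNReal.ofReal_ne_top hμ
  have hmain := hHardy u hLip huc (hsupp.trans hθΩ) _ hug
  have hpt : ∀ x ∈ Ω, ENNReal.ofReal (θ x ^ (n + 1) * (δ * peak δ H (infDist x Ωᶜ) / infDist x Ωᶜ) +
        (n + 1) * (θ x ^ n * peak δ H (infDist x Ωᶜ) * G x)) ^ p *
        ENNReal.ofReal (infDist x Ωᶜ ^ β) ≤
      ENNReal.ofReal (2 ^ p * δ ^ p + 2 ^ p * ((n + 1) ^ p * τ ^ p)) * ENNReal.ofReal (w x) +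
        ENNReal.ofReal (2 ^ p * (n + 1) ^ p) * N x := by
    intro x hx
    have hd := hdpos x hx
    have hF := peak_nonneg (δ := δ) hH hd.le
    have hθx := hθ0 x
    have hGx := hG0 x
    set d := infDist x Ωᶜ
    set F := peak δ H d
    -- The derivative of the profile reproduces the left integrand with the small factor `δ ^ p`.
    have hA : (θ x ^ (n + 1) * (δ * F / d)) ^ p * d ^ β = δ ^ p * w x := by
      have : θ x ^ (n + 1) * (δ * F / d) = δ * u x / d := by simp only [hu, F, d]; ring
      rw [this, Real.div_rpow (mul_nonneg hδ (hu0 x)) hd.le, Real.mul_rpow hδ (hu0 x)]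
      simp only [hw]
      rw [Real.rpow_sub hd]
      ring
    rw [ENNReal.ofReal_rpow_of_nonneg (by positivity) hp0.le, ← ENNReal.ofReal_mul (by positivity)]
    set B := (θ x ^ n * F * G x) ^ p * d ^ β with hB
    have hB0 : 0 ≤ B := by positivity
    have step : (θ x ^ (n + 1) * (δ * F / d) + (n + 1) * (θ x ^ n * F * G x)) ^ p * d ^ β ≤
        2 ^ p * δ ^ p * w x + 2 ^ p * (n + 1) ^ p * B := by
      have h1 := add_rpow_le_two_rpow_mul (a := θ x ^ (n + 1) * (δ * F / d))
        (b := (n + 1) * (θ x ^ n * F * G x)) (by positivity) (by positivity) hp0.le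
      calc _ ≤ 2 ^ p * ((θ x ^ (n + 1) * (δ * F / d)) ^ p +
            ((n + 1) * (θ x ^ n * F * G x)) ^ p) * d ^ β := by gcongr
        _ = 2 ^ p * ((θ x ^ (n + 1) * (δ * F / d)) ^ p * d ^ β) + 2 ^ p * (n + 1) ^ p * B := by
            rw [Real.mul_rpow (x := (n : ℝ) + 1) (by positivity) (by positivity), hB]; ring
        _ = _ := by rw [hA]; ring
    have hw0x := hw0 x
    calc _ ≤ ENNReal.ofReal (2 ^ p * δ ^ p * w x + 2 ^ p * (n + 1) ^ p * B) :=
          ENNReal.ofReal_le_ofReal step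
      _ = ENNReal.ofReal (2 ^ p * δ ^ p * w x) +
          ENNReal.ofReal (2 ^ p * (n + 1) ^ p) * ENNReal.ofReal B := by
          rw [ENNReal.ofReal_add (by positivity) (by positivity),
            ENNReal.ofReal_mul (p := 2 ^ p * ((n : ℝ) + 1) ^ p) (by positivity)]
      _ ≤ ENNReal.ofReal (2 ^ p * δ ^ p * w x) + ENNReal.ofReal (2 ^ p * (n + 1) ^ p) *
          (ENNReal.ofReal (τ ^ p * w x) + N x) := by
          gcongr
          exact hN x hx
      _ = _ := by
          rw [mul_add, ← ENNReal.ofReal_mul (by positivity), ← add_assoc,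
            ← ENNReal.ofReal_add (by positivity) (by positivity),
            ← ENNReal.ofReal_mul (by positivity)]
          congr 3
          ring
  have habs : ∫⁻ x in Ω, ENNReal.ofReal (|u x| ^ p * infDist x Ωᶜ ^ (β - p)) ∂μ = W := by
    simp only [hW, hw, abs_of_nonneg (hu0 _)]
  rw [habs] at hmain
  set c : ℝ := 2 ^ p * δ ^ p + 2 ^ p * ((n + 1) ^ p * τ ^ p) with hc
  set D : ℝ≥0∞ := ENNReal.ofReal (2 ^ p * (n + 1) ^ p) with hD
  have h2 : W ≤ C * (ENNReal.ofReal c * W + D * ∫⁻ x in Ω, N x ∂μ) := by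
    refine hmain.trans ?_
    gcongr
    calc _ ≤ ∫⁻ x in Ω, (ENNReal.ofReal c * ENNReal.ofReal (w x) + D * N x) ∂μ :=
          setLIntegral_mono' hΩ.measurableSet hpt
      _ = _ := by
          rw [lintegral_add_left (by fun_prop), lintegral_const_mul _ (by fun_prop),
            lintegral_const_mul _ hNm]
  have h3 : (C : ℝ≥0∞) * ENNReal.ofReal c ≤ 2⁻¹ := by
    rw [← ENNReal.ofReal_coe_nnreal, ← ENNReal.ofReal_mul (NNReal.coe_nonneg C)]
    have : (2⁻¹ : ℝ≥0∞) = ENNReal.ofReal 2⁻¹ := by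
      rw [ENNReal.ofReal_inv_of_pos (by norm_num)]; simp
    rw [this]
    refine ENNReal.ofReal_le_ofReal ?_
    rw [hc, mul_add]; linarith
  set I := ∫⁻ x in Ω, N x ∂μ
  have h4 : W ≤ 2⁻¹ * W + C * D * I := by
    calc W ≤ C * (ENNReal.ofReal c * W + D * I) := h2
      _ = (C * ENNReal.ofReal c) * W + C * D * I := by ring
      _ ≤ _ := by gcongr
  have h5 : 2⁻¹ * W ≤ C * D * I := by
    have hfin : 2⁻¹ * W ≠ ∞ := ENNReal.mul_ne_top (by simp) hWfin
    refine (ENNReal.add_le_add_iff_left hfin).1 ?_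
    rwa [← add_mul, ENNReal.inv_two_add_inv_two, one_mul]
  calc W = 2 * (2⁻¹ * W) := by
        rw [← mul_assoc, ENNReal.mul_inv_cancel (by norm_num) (by norm_num), one_mul]
    _ ≤ 2 * (C * D * I) := by gcongr
    _ = _ := by ring

/-! ### Doubling measures and covers of small content. -/

namespace IsDoublingWith
variable {X : Type*} [MetricSpace X] [MeasurableSpace X] {μ : Measure X} {C : ℝ≥0}

theorem measure_closedBall_two_pow_mul_le (h : IsDoublingWith μ C) (x : X) {r : ℝ} (hr : 0 < r)
    (m : ℕ) : μ (closedBall x (2 ^ m * r)) ≤ C ^ m * μ (closedBall x r) := by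
  induction m with
  | zero => simp
  | succ m ih =>
    rw [pow_succ', mul_assoc]
    refine (h.doubling x _ (by positivity)).trans ?_
    rw [pow_succ', mul_assoc]
    gcongr

/-- Disjoint balls of radius `ε / 8` centred in a fixed ball have measure bounded below by doubling
and lie in a set of finite measure. There are finitely many, and by Vitali their enlargements cover.
-/
theorem properSpace [CompleteSpace X] [BorelSpace X] (h : IsDoublingWith μ C) : ProperSpace X := by
  refine ProperSpace.of_isCompact_closedBall_of_le 1 fun x R hR => ?_
  have hR0 : 0 < R := by linarith
  refine TotallyBounded.isCompact_of_isClosed ?_ isClosed_closedBall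
  refine Metric.totallyBounded_iff.2 fun ε hε => ?_
  obtain ⟨u, hu, hdisj, hcov⟩ := Vitali.exists_disjoint_subfamily_covering_enlargement_closedBall
    (closedBall x R) (fun y => y) (fun _ => ε / 8) (ε / 8) (fun _ _ => le_rfl) 4 (by norm_num)
  obtain ⟨m, hm⟩ : ∃ m : ℕ, 2 * R ≤ 2 ^ m * (ε / 8) := by
    obtain ⟨m, hm⟩ := pow_unbounded_of_one_lt (2 * R / (ε / 8)) (one_lt_two (α := ℝ))
    exact ⟨m, by rw [div_lt_iff₀ (by positivity)] at hm; exact hm.le⟩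
  refine ⟨u, ?_, fun y hy => ?_⟩
  · have hlow : ∀ b : u, μ (closedBall x R) / (C : ℝ≥0∞) ^ m ≤ μ (closedBall (b : X) (ε / 8)) := by
      intro b
      refine ENNReal.div_le_of_le_mul' ?_
      refine (measure_mono ?_).trans (h.measure_closedBall_two_pow_mul_le b (by positivity) m)
      refine closedBall_subset_closedBall' ?_
      have := mem_closedBall'.1 (hu b.2)
      rw [dist_comm] at this
      linarith [dist_comm x (b : X)]
    have hfin := Measure.finite_const_le_meas_of_disjoint_iUnion μ
      (ε := μ (closedBall x R) / (C : ℝ≥0∞) ^ m)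
      (As := fun b : u => closedBall (b : X) (ε / 8))
      (ENNReal.div_pos (h.measure_pos x R hR0).ne' (by simp))
      (fun b => isClosed_closedBall.measurableSet)
      (fun a b hab => hdisj a.2 b.2 (by simpa [Subtype.ext_iff] using hab)) (by
        refine ne_top_of_le_ne_top (h.measure_lt_top x (R + ε / 8) (by positivity)).ne
          (measure_mono ?_)
        refine iUnion_subset fun b => closedBall_subset_closedBall' ?_
        have := mem_closedBall.1 (hu b.2)
        linarith)
    have : Finite u := by
      rw [← Set.finite_univ_iff]
      exact hfin.subset fun b _ => hlow b
    exact Set.toFinite u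
  · obtain ⟨b, hb, hsub⟩ := hcov y hy
    refine mem_iUnion₂.2 ⟨b, hb, ?_⟩
    have := hsub (mem_closedBall_self (by positivity))
    rw [mem_closedBall] at this
    rw [mem_ball]
    linarith

/-- A compact set of vanishing content of codimension `q` has finite covers by small balls with
small sums `∑ rad(B) ^ (-s) μ(4B)`, for each `s ≤ q`. -/
theorem exists_finite_cover (h : IsDoublingWith μ C) {E : Set X} (hE : IsCompact E) {q s : ℝ}
    (hq : ∀ R : ℝ, 0 < R → hausdorffCocontent μ R q E = 0) (hs : s ≤ q) {R : ℝ} (hR : 0 < R)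
    {η : ℝ≥0∞} (hη : 0 < η) :
    ∃ F : Finset (X × ℝ), (∀ b ∈ F, 0 < b.2 ∧ b.2 ≤ R ∧ (closedBall b.1 b.2 ∩ E).Nonempty) ∧
      (E ⊆ ⋃ b ∈ F, ball b.1 (2 * b.2)) ∧
      ∑ b ∈ F, ENNReal.ofReal (b.2 ^ (-s)) * μ (closedBall b.1 (4 * b.2)) ≤ η := by
  classical
  -- The factor `C ^ 2` pays for enlarging `B` to `4B`.
  have hη' : 0 < η / (C : ℝ≥0∞) ^ 2 := ENNReal.div_pos hη.ne' (by simp)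
  -- Radii at most `1` make `rad ^ (-s) ≤ rad ^ (-q)` for `s ≤ q`.
  have h0 := hq (min R 1) (by positivity)
  unfold hausdorffCocontent at h0
  rw [← h0] at hη'
  simp only [iInf_lt_iff] at hη'
  obtain ⟨F₀, -, hF₀, hcov, hlt⟩ := hη'
  obtain ⟨F, hFsub, hFfin, hFcov⟩ := hE.elim_finite_subcover_image
    (b := {b ∈ F₀ | (closedBall b.1 b.2 ∩ E).Nonempty}) (c := fun b => ball b.1 (2 * b.2))
    (fun _ _ => isOpen_ball) (fun x hx => by
      obtain ⟨b, hb, hxb⟩ := mem_iUnion₂.1 (hcov hx)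
      refine mem_iUnion₂.2 ⟨b, ⟨hb, x, hxb, hx⟩, ?_⟩
      have := (hF₀ b hb).1
      rw [mem_closedBall] at hxb
      rw [mem_ball]
      linarith)
  refine ⟨hFfin.toFinset, fun b hb => ?_, by simpa using hFcov, ?_⟩
  · have hb' := hFsub (hFfin.mem_toFinset.1 hb)
    exact ⟨(hF₀ b hb'.1).1, (hF₀ b hb'.1).2.trans (min_le_left _ _), hb'.2⟩
  have hsum : ∑ b ∈ hFfin.toFinset, ENNReal.ofReal (b.2 ^ (-q)) * μ (closedBall b.1 b.2) ≤
      ∑' b : F₀, ENNReal.ofReal (b.1.2 ^ (-q)) * μ (closedBall b.1.1 b.1.2) := by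
    rw [tsum_subtype F₀ fun b : X × ℝ => ENNReal.ofReal (b.2 ^ (-q)) * μ (closedBall b.1 b.2)]
    refine le_trans (Finset.sum_le_sum fun b hb => ?_) (ENNReal.sum_le_tsum hFfin.toFinset)
    rw [indicator_of_mem (hFsub (hFfin.mem_toFinset.1 hb)).1]
  calc _ ≤ ∑ b ∈ hFfin.toFinset,
        C ^ 2 * (ENNReal.ofReal (b.2 ^ (-q)) * μ (closedBall b.1 b.2)) := by
        refine Finset.sum_le_sum fun b hb => ?_
        have hb' := hF₀ b (hFsub (hFfin.mem_toFinset.1 hb)).1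
        have h1 : b.2 ^ (-s) ≤ b.2 ^ (-q) :=
          Real.rpow_le_rpow_of_exponent_ge hb'.1 (hb'.2.trans (min_le_right _ _)) (by linarith)
        have h2 := h.measure_closedBall_two_pow_mul_le b.1 hb'.1 2
        norm_num at h2
        calc _ ≤ ENNReal.ofReal (b.2 ^ (-q)) * (C ^ 2 * μ (closedBall b.1 b.2)) := by gcongr
          _ = _ := by ring
    _ ≤ C ^ 2 * (η / C ^ 2) := by
        rw [← Finset.mul_sum]
        gcongr
        exact hsum.trans hlt.le
    _ ≤ η := ENNReal.mul_div_le

/-- For radii at most `1` and `s ≥ 0` the weights `rad ^ (-s)` are at least `1`, so the sums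
dominate the measure. Finiteness of `μ E` comes first, to make `μ E / 2 < μ E` strict. -/
theorem measure_eq_zero_of_hausdorffCocontent (h : IsDoublingWith μ C) {E : Set X}
    (hE : IsCompact E) {q s : ℝ} (hq : ∀ R : ℝ, 0 < R → hausdorffCocontent μ R q E = 0)
    (hs : s ≤ q) (hs0 : 0 ≤ s) : μ E = 0 := by
  by_contra hne
  have hpos : 0 < μ E := pos_iff_ne_zero.2 hne
  have hfin : μ E ≠ ∞ := by
    obtain ⟨F, hF, hcov, -⟩ := h.exists_finite_cover hE hq hs one_pos one_pos
    refine ne_top_of_le_ne_top ?_ ((measure_mono hcov).trans (measure_biUnion_finset_le _ _))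
    refine (ENNReal.sum_lt_top.2 fun b hb => ?_).ne
    exact (measure_mono ball_subset_closedBall).trans_lt
      (h.measure_lt_top _ _ (mul_pos two_pos (hF b hb).1))
  obtain ⟨F, hF, hcov, hsum⟩ := h.exists_finite_cover hE hq hs one_pos (ENNReal.half_pos hne)
  refine absurd (ENNReal.half_lt_self hne hfin) (not_lt.2 ?_)
  refine (measure_mono hcov).trans ((measure_biUnion_finset_le _ _).trans (le_trans ?_ hsum))
  refine Finset.sum_le_sum fun b hb => ?_
  obtain ⟨hb0, hb1, -⟩ := hF b hb
  have h1 : 1 ≤ b.2 ^ (-s) := Real.one_le_rpow_of_pos_of_le_one_of_nonpos hb0 hb1 (by linarith)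
  calc _ ≤ 1 * μ (closedBall b.1 (4 * b.2)) := by
        rw [one_mul]
        exact measure_mono (ball_subset_closedBall.trans
          (closedBall_subset_closedBall (by linarith)))
    _ ≤ _ := by
        gcongr
        exact ENNReal.one_le_ofReal.2 h1
end IsDoublingWith

/-! ### Minima of cutoffs in the Hardy inequality. -/

theorem abs_inf'_sub_inf'_le {X ι : Type*} [MetricSpace X] [Fintype ι] [Nonempty ι]
    {f : ι → X → ℝ} {x y : X} {c : ℝ} (h : ∀ i, |f i y - f i x| ≤ c) :
    |Finset.univ.inf' Finset.univ_nonempty (fun i => f i y) -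
      Finset.univ.inf' Finset.univ_nonempty (fun i => f i x)| ≤ c := by
  have key : ∀ x y : X, (∀ i, |f i y - f i x| ≤ c) →
      Finset.univ.inf' Finset.univ_nonempty (fun i => f i y) -
      Finset.univ.inf' Finset.univ_nonempty (fun i => f i x) ≤ c := by
    intro x y h
    obtain ⟨i, -, hi⟩ := Finset.exists_mem_eq_inf' Finset.univ_nonempty (fun i => f i x)
    rw [hi]
    have := Finset.inf'_le (fun i => f i y) (Finset.mem_univ i)
    linarith [(abs_le.1 (h i)).2]
  rw [abs_le]
  constructor
  · have := key y x fun i => by rw [abs_sub_comm]; exact h i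
    linarith
  · exact key x y h

/-- The reason for the power of `θ` in the test function: when `γ < 0` the factor `d ^ γ` may blow
up, but `d > τ θ ρ` lets `θ ^ m` compensate. When `γ ≥ 0` the bound `d ≤ 6 ρ` suffices. -/
theorem rpow_mul_rpow_le_of_mul_lt {θ d ρ τ γ m : ℝ} (hθ0 : 0 ≤ θ) (hθ1 : θ ≤ 1) (hρ : 0 < ρ)
    (hd : 0 < d) (hdρ : d ≤ 6 * ρ) (hτ : 0 < τ) (hτ1 : τ ≤ 1) (hγ : |γ| ≤ m)
    (h : τ * θ * ρ < d) : θ ^ m * d ^ γ ≤ (6 / τ) ^ m * ρ ^ γ := by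
  have hm : 0 ≤ m := (abs_nonneg _).trans hγ
  have h6 : 1 ≤ 6 / τ := by rw [le_div_iff₀ hτ]; linarith
  rcases le_or_gt 0 γ with hγ0 | hγ0
  · rw [abs_of_nonneg hγ0] at hγ
    calc θ ^ m * d ^ γ ≤ 1 * (6 * ρ) ^ γ := by
          gcongr
          exact Real.rpow_le_one hθ0 hθ1 hm
      _ = 6 ^ γ * ρ ^ γ := by rw [one_mul, Real.mul_rpow (by norm_num) hρ.le]
      _ ≤ _ := by
          gcongr
          calc (6 : ℝ) ^ γ ≤ (6 / τ) ^ γ := by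
                gcongr
                rw [le_div_iff₀ hτ]; linarith
            _ ≤ _ := Real.rpow_le_rpow_of_exponent_le h6 hγ
  · rw [abs_of_neg hγ0] at hγ
    rcases hθ0.eq_or_lt with rfl | hθ
    · rw [Real.zero_rpow (by linarith), zero_mul]
      positivity
    calc θ ^ m * d ^ γ ≤ θ ^ m * (τ * θ * ρ) ^ γ := by
          gcongr ?_ * ?_
          exact Real.rpow_le_rpow_of_nonpos (by positivity) h.le hγ0.le
      _ = θ ^ (m + γ) * (τ⁻¹ ^ (-γ) * ρ ^ γ) := by
          rw [Real.mul_rpow (by positivity) hρ.le, Real.mul_rpow hτ.le hθ.le,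
            Real.rpow_add hθ, Real.inv_rpow hτ.le, Real.rpow_neg hτ.le, inv_inv]
          ring
      _ ≤ 1 * ((6 / τ) ^ m * ρ ^ γ) := by
          gcongr
          · exact Real.rpow_le_one hθ.le hθ1 (by linarith)
          · calc τ⁻¹ ^ (-γ) ≤ (6 / τ) ^ (-γ) := by
                  refine Real.rpow_le_rpow (by positivity) ?_ (by linarith)
                  rw [div_eq_mul_inv]
                  linarith [inv_pos.2 hτ]
              _ ≤ _ := Real.rpow_le_rpow_of_exponent_le h6 hγ
      _ = _ := one_mul _

/-- The Hardy inequality tested with a product of powers of the distance to the boundary and of a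
minimum of cutoff functions `f i`, each of which is `1 / ρ i`-Lipschitz and locally constant outside
`A i`. -/
theorem AdmitsHardyWith.lintegral_inf_cutoff_le {X : Type*} [MetricSpace X] [MeasurableSpace X]
    [BorelSpace X] {μ : Measure X} {Ω : Set X} {p β : ℝ} {C : ℝ≥0}
    (hHardy : AdmitsHardyWith μ Ω p β C) (hp : 1 ≤ p)
    (hΩ : IsOpen Ω) (hne : Ωᶜ.Nonempty) {δ H : ℝ} (hδ : 0 ≤ δ) (hH : 0 < H)
    {ι : Type*} [Fintype ι] [Nonempty ι] {A : ι → Set X} {ρ M e : ι → ℝ} {f : ι → X → ℝ}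
    (hA : ∀ i, IsClosed (A i)) (hρ : ∀ i, 0 < ρ i) (hM : ∀ i, 0 ≤ M i)
    (hMe : ∀ i, ∀ s, 0 < s → peak δ H s ≤ M i * s ^ e i)
    (hf0 : ∀ i x, 0 ≤ f i x) (hf1 : ∀ i x, f i x ≤ 1)
    (hfL : ∀ i x y, |f i y - f i x| ≤ (ρ i)⁻¹ * dist y x)
    (hfA : ∀ i, ∀ x ∉ A i, ∀ᶠ y in 𝓝 x, f i y = f i x)
    (hdA : ∀ i, ∀ x ∈ A i, infDist x Ωᶜ ≤ 6 * ρ i) {θ : X → ℝ}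
    (hθ : ∀ x, θ x = Finset.univ.inf' Finset.univ_nonempty (fun i => f i x))
    (hθc : HasCompactSupport θ) (hθΩ : tsupport θ ⊆ Ω) (hμ : μ (tsupport θ) ≠ ∞)
    {n : ℕ} (hn : ∀ i, |β + e i * p| ≤ n * p) {τ : ℝ} (hτ : 0 < τ) (hτ1 : τ ≤ 1)
    (hδC : C * (2 ^ p * δ ^ p) ≤ 1 / 4) (hτC : C * (2 ^ p * ((n + 1) ^ p * τ ^ p)) ≤ 1 / 4) :
    ∫⁻ x in Ω, ENNReal.ofReal ((θ x ^ (n + 1) * peak δ H (infDist x Ωᶜ)) ^ p *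
        infDist x Ωᶜ ^ (β - p)) ∂μ ≤
      2 * C * ENNReal.ofReal (2 ^ p * (n + 1) ^ p) *
        ∑ i, ENNReal.ofReal ((6 / τ) ^ (n * p) * (M i ^ p * ρ i ^ (β + e i * p - p))) *
          μ (A i) := by
  classical
  have hp0 : 0 < p := by linarith
  have hθ0 : ∀ x, 0 ≤ θ x := fun x => by
    rw [hθ]; exact Finset.le_inf' _ _ fun i _ => hf0 i x
  have hθ1 : ∀ x, θ x ≤ 1 := fun x => by
    rw [hθ]
    exact (Finset.inf'_le _ (Finset.mem_univ (Classical.arbitrary ι))).trans (hf1 _ x)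
  set G : X → ℝ := fun x =>
    Finset.univ.sup' Finset.univ_nonempty (fun i => (A i).indicator (fun _ => (ρ i)⁻¹) x) with hGdef
  have hGi : ∀ i x, (A i).indicator (fun _ => (ρ i)⁻¹) x ≤ G x := fun i x =>
    Finset.le_sup' (fun i => (A i).indicator (fun _ => (ρ i)⁻¹) x) (Finset.mem_univ i)
  have hG0 : ∀ x, 0 ≤ G x := fun x =>
    (indicator_nonneg (fun _ _ => (inv_pos.2 (hρ _)).le) x).trans (hGi (Classical.arbitrary ι) x)
  have hGm : Measurable G := by
    have := Finset.measurable_sup' (Finset.univ_nonempty (α := ι))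
      (f := fun i x => (A i).indicator (fun _ => (ρ i)⁻¹) x)
      fun i _ => measurable_const.indicator (hA i).measurableSet
    convert this using 1
    funext x
    simp [hGdef, Finset.sup'_apply]
  have hG : ∀ x, ∀ᶠ y in 𝓝 x, |θ y - θ x| ≤ G x * dist y x := by
    intro x
    have : ∀ i, ∀ᶠ y in 𝓝 x, |f i y - f i x| ≤ G x * dist y x := by
      intro i
      by_cases hx : x ∈ A i
      · refine Eventually.of_forall fun y => (hfL i x y).trans ?_
        have := hGi i x
        rw [indicator_of_mem hx] at this
        gcongr
      · filter_upwards [hfA i x hx] with y hy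
        rw [hy, sub_self, abs_zero]
        exact mul_nonneg (hG0 x) dist_nonneg
    filter_upwards [eventually_all.2 this] with y hy
    rw [hθ, hθ]
    exact abs_inf'_sub_inf'_le hy
  obtain ⟨L, hθL⟩ : ∃ L, LipschitzWith L θ := by
    obtain ⟨c, hc⟩ := (Set.finite_range fun i => (ρ i)⁻¹).bddAbove
    refine ⟨c.toNNReal, LipschitzWith.of_dist_le_mul fun x y => ?_⟩
    rw [Real.dist_eq, hθ, hθ]
    refine abs_inf'_sub_inf'_le fun i => (hfL i y x).trans ?_
    have := (hc (mem_range_self i)).trans (Real.le_coe_toNNReal c)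
    gcongr
  have hdpos : ∀ x ∈ Ω, 0 < infDist x Ωᶜ := fun x hx =>
    (hΩ.isClosed_compl.notMem_iff_infDist_pos hne).1 (by simpa using hx)
  set b : ι → ℝ≥0∞ := fun i =>
    ENNReal.ofReal ((6 / τ) ^ (n * p) * (M i ^ p * ρ i ^ (β + e i * p - p))) with hb
  have hNm : Measurable fun x => ∑ i, (A i).indicator (fun _ => b i) x :=
    Finset.measurable_sum _ fun i _ => measurable_const.indicator (hA i).measurableSet
  refine (hHardy.lintegral_pow_mul_peak_le hp hΩ hne hδ hH hθL hθ0 hθ1 hθc hθΩ hμ hGm hG0 hG n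
    hτ.le hδC hτC (N := fun x => ∑ i, (A i).indicator (fun _ => b i) x) hNm ?_).trans ?_
  · intro x hx
    have hd := hdpos x hx
    have hF := peak_nonneg (δ := δ) hH hd.le
    have hFM := fun i => hMe i _ hd
    have hθx := hθ0 x
    obtain ⟨i, -, hi⟩ := Finset.exists_mem_eq_sup' Finset.univ_nonempty
      (fun i => (A i).indicator (fun _ => (ρ i)⁻¹) x)
    replace hi : G x = (A i).indicator (fun _ => (ρ i)⁻¹) x := hi
    by_cases hxA : x ∈ A i
    swap
    · rw [hi, indicator_of_notMem hxA, mul_zero, Real.zero_rpow hp0.ne', zero_mul]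
      simp
    rw [indicator_of_mem hxA] at hi
    rw [hi]
    have hdA' := hdA i x hxA
    have hρi := hρ i
    replace hFM := hFM i
    have hMi := hM i
    set d := infDist x Ωᶜ
    set F := peak δ H d
    -- If `d ≤ τ θ ρ`, the gradient term of the cutoff is at most `τ u / d` and is absorbed.
    -- Otherwise `rpow_mul_rpow_le_of_mul_lt` replaces powers of `d` by powers of `ρ`.
    rcases le_or_gt d (τ * θ x * ρ i) with hcase | hcase
    · refine le_add_right (ENNReal.ofReal_le_ofReal ?_)
      have h1 : θ x ^ n * F * (ρ i)⁻¹ ≤ τ * (θ x ^ (n + 1) * F) / d := by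
        rw [le_div_iff₀ hd, ← div_eq_mul_inv, div_mul_eq_mul_div, div_le_iff₀ hρi]
        calc θ x ^ n * F * d ≤ θ x ^ n * F * (τ * θ x * ρ i) := by gcongr
          _ = _ := by ring
      calc _ ≤ (τ * (θ x ^ (n + 1) * F) / d) ^ p * d ^ β := by gcongr
        _ = _ := by
          rw [Real.div_rpow (by positivity) hd.le, Real.mul_rpow hτ.le (by positivity),
            Real.rpow_sub hd]
          ring
    · refine le_add_left (le_trans ?_ (Finset.single_le_sum
        (f := fun i => (A i).indicator (fun _ => b i) x) (fun _ _ => bot_le)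
        (Finset.mem_univ i)))
      simp only [indicator_of_mem hxA, hb]
      refine ENNReal.ofReal_le_ofReal ?_
      have h1 := rpow_mul_rpow_le_of_mul_lt (hθ0 x) (hθ1 x) hρi hd hdA' hτ hτ1 (hn i) hcase
      calc (θ x ^ n * F * (ρ i)⁻¹) ^ p * d ^ β
          ≤ (θ x ^ n * (M i * d ^ e i) * (ρ i)⁻¹) ^ p * d ^ β := by gcongr
        _ = M i ^ p * (ρ i ^ p)⁻¹ * (θ x ^ (n * p) * d ^ (β + e i * p)) := by
            rw [Real.mul_rpow (by positivity) (by positivity),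
              Real.mul_rpow (by positivity) (by positivity),
              Real.mul_rpow (by positivity) (by positivity), Real.inv_rpow hρi.le,
              ← Real.rpow_natCast (θ x) n, ← Real.rpow_mul hθx, ← Real.rpow_mul hd.le,
              Real.rpow_add hd]
            ring
        _ ≤ M i ^ p * (ρ i ^ p)⁻¹ * ((6 / τ) ^ (n * p) * ρ i ^ (β + e i * p)) := by gcongr
        _ = _ := by
            rw [Real.rpow_sub hρi]
            ring
  · gcongr
    refine (setLIntegral_le_lintegral _ _).trans ?_
    rw [lintegral_finsetSum _ fun i _ => measurable_const.indicator (hA i).measurableSet]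
    refine Finset.sum_le_sum fun i _ => ?_
    rw [lintegral_indicator (hA i).measurableSet, setLIntegral_const]

theorem exists_pos_mul_rpow_le {K p m : ℝ} (hK : 0 ≤ K) (hp : 0 < p) (hm : 0 < m) :
    ∃ δ, 0 < δ ∧ δ ≤ m ∧ K * δ ^ p ≤ 1 / 4 := by
  have hpos : 0 < 1 / (4 * (K + 1)) := by positivity
  refine ⟨min m ((1 / (4 * (K + 1))) ^ p⁻¹), by positivity, min_le_left _ _, ?_⟩
  calc K * (min m ((1 / (4 * (K + 1))) ^ p⁻¹)) ^ p
      ≤ K * ((1 / (4 * (K + 1))) ^ p⁻¹) ^ p := by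
        gcongr
        exact min_le_right _ _
    _ = K * (1 / (4 * (K + 1))) := by rw [Real.rpow_inv_rpow hpos.le hp.ne']
    _ ≤ 1 / 4 := by
        rw [mul_one_div, div_le_div_iff₀ (by positivity) (by norm_num)]
        linarith

/-! ### Cutoffs built from distances to points. -/

/-- The retraction of the real line to the unit interval. -/
noncomputable def unitClamp (s : ℝ) : ℝ := max (min s 1) 0

theorem unitClamp_nonneg (s : ℝ) : 0 ≤ unitClamp s := le_max_right _ _

theorem unitClamp_le_one (s : ℝ) : unitClamp s ≤ 1 := max_le (min_le_right _ _) zero_le_one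

theorem unitClamp_of_one_le {s : ℝ} (h : 1 ≤ s) : unitClamp s = 1 := by
  simp [unitClamp, min_eq_right h]

theorem unitClamp_of_nonpos {s : ℝ} (h : s ≤ 0) : unitClamp s = 0 :=
  max_eq_right ((min_le_left _ _).trans h)

theorem abs_unitClamp_sub_le (s t : ℝ) : |unitClamp s - unitClamp t| ≤ |s - t| := by
  have h1 := abs_max_sub_max_le_abs (min s 1) (min t 1) 0
  exact h1.trans (abs_inf_sub_inf_le_abs s t 1)

theorem abs_unitClamp_div_sub_le {X : Type*} [MetricSpace X] (c x y : X) {r : ℝ} (hr : 0 < r)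
    (k : ℝ) :
    |unitClamp (dist y c / r - k) - unitClamp (dist x c / r - k)| ≤ r⁻¹ * dist y x := by
  refine (abs_unitClamp_sub_le _ _).trans ?_
  have e : dist y c / r - k - (dist x c / r - k) = r⁻¹ * (dist y c - dist x c) := by
    field_simp; ring
  rw [e, abs_mul, abs_of_pos (inv_pos.2 hr)]
  gcongr
  exact abs_dist_sub_le y x c

theorem abs_unitClamp_sub_div_le {X : Type*} [MetricSpace X] (c x y : X) {r : ℝ} (hr : 0 < r)
    (k : ℝ) :
    |unitClamp ((k - dist y c) / r) - unitClamp ((k - dist x c) / r)| ≤ r⁻¹ * dist y x := by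
  refine (abs_unitClamp_sub_le _ _).trans ?_
  have e : (k - dist y c) / r - (k - dist x c) / r = r⁻¹ * (dist x c - dist y c) := by
    field_simp; ring
  rw [e, abs_mul, abs_of_pos (inv_pos.2 hr), dist_comm y x]
  gcongr
  exact abs_dist_sub_le x y c

/-! ### Measure of neighbourhoods of the boundary. -/

section
variable {X : Type*} [MetricSpace X] [ProperSpace X] [MeasurableSpace X] [BorelSpace X]
  {μ : Measure X} {Ω : Set X} {p β : ℝ} {C_D C : ℝ≥0}

/-- The constant does not depend on `a`: the parameter `H` and the cover do, but the cover is chosen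
after `H` and its cost is dominated by that of the outer cutoff. -/
theorem AdmitsHardyWith.measure_layer_le (hHardy : AdmitsHardyWith μ Ω p β C)
    (h : IsDoublingWith μ C_D) (hp : 1 ≤ p) (hΩ : IsOpen Ω) (hne : Ωᶜ.Nonempty) {δ : ℝ}
    (hδ : 0 ≤ δ) {n : ℕ} (hn : |β| + δ * p ≤ n * p) {τ : ℝ} (hτ : 0 < τ) (hτ1 : τ ≤ 1)
    (hδC : C * (2 ^ p * δ ^ p) ≤ 1 / 4) (hτC : C * (2 ^ p * ((n + 1) ^ p * τ ^ p)) ≤ 1 / 4)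
    (ht : 0 ≤ p - β + δ * p) {S : Set X} (hS : IsCompact S) {q : ℝ}
    (hq : ∀ R : ℝ, 0 < R → hausdorffCocontent μ R q (S ∩ Ωᶜ) = 0) (hqs : p - β - δ * p ≤ q)
    {c : X} {r₁ r : ℝ} (hr : 0 < r) (hr₁ : 0 ≤ r₁) (hcS : closedBall c (r₁ + r) ⊆ S)
    (hcd : ∀ y ∈ closedBall c (r₁ + r), infDist y Ωᶜ ≤ 6 * r) {a s : ℝ} (ha : 0 < a) (hs : 0 < s) :
    μ ({y | a ≤ infDist y Ωᶜ ∧ infDist y Ωᶜ < s} ∩ closedBall c r₁) ≤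
      ENNReal.ofReal (2 ^ p * (2 * C * (2 ^ p * (n + 1) ^ p) * (2 * (6 / τ) ^ (n * p))) *
        (s / r) ^ (p - β + δ * p)) * μ (closedBall c (r₁ + r)) := by
  classical
  have hp0 : 0 < p := by linarith
  set t := p - β + δ * p with ht_def
  set A₀ := closedBall c (r₁ + r) with hA₀
  -- The profile switches at distance `a`, so `F ≥ d ^ (-δ) / 2` on the layer.
  set H : ℝ := (a ^ δ) ^ 2 with hH_def
  have hH : 0 < H := by positivity
  set D : ℝ := (6 / τ) ^ (n * p) with hD_def
  have hD : 0 < D := by positivity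
  have hA₀pos : 0 < μ A₀ := h.measure_pos _ _ (by linarith)
  -- This bound on the covering sum cancels the factor `H⁻¹ ^ p` and leaves exactly the cost of the
  -- outer ball.
  have hη : 0 < ENNReal.ofReal (r ^ (-t)) * μ A₀ / ENNReal.ofReal (H⁻¹ ^ p) :=
    ENNReal.div_pos (mul_ne_zero (by simpa using Real.rpow_pos_of_pos hr _) hA₀pos.ne')
      ENNReal.ofReal_ne_top
  -- Radii at most `a / 4` keep points with `d_Ω ≥ a` at distance at least `a - rad ≥ 3 rad` from
  -- the centres, where the cutoffs equal `1`.
  obtain ⟨F, hF, hFcov, hFsum⟩ := h.exists_finite_cover (hS.inter_right hΩ.isClosed_compl) hq hqs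
    (R := a / 4) (by positivity) hη
  -- The index `none` is the outer cutoff, with profile bound `s ^ (-δ)`. The others vanish on `2B`,
  -- equal `1` off `3B`, hence are locally constant off `4B`, and use the bound `s ^ δ / H`.
  set A : Option F → Set X := fun i => i.elim A₀ fun b => closedBall b.1.1 (4 * b.1.2) with hA
  set ρ : Option F → ℝ := fun i => i.elim r fun b => b.1.2 with hρ
  set M : Option F → ℝ := fun i => i.elim 1 fun _ => H⁻¹ with hM
  set e : Option F → ℝ := fun i => i.elim (-δ) fun _ => δ with he
  set f : Option F → X → ℝ := fun i => i.elim (fun y => unitClamp ((r₁ + r - dist y c) / r))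
    fun b y => unitClamp (dist y b.1.1 / b.1.2 - 2) with hf
  have hFpos : ∀ b : F, 0 < b.1.2 := fun b => (hF b.1 b.2).1
  set θ : X → ℝ := fun x => Finset.univ.inf' Finset.univ_nonempty (fun i => f i x) with hθ
  have hf0 : ∀ i x, 0 ≤ f i x := by
    rintro (_ | b) x <;> exact unitClamp_nonneg _
  have hf1 : ∀ i x, f i x ≤ 1 := by
    rintro (_ | b) x <;> exact unitClamp_le_one _
  have hθf : ∀ i x, f i x = 0 → θ x = 0 := fun i x hi => by
    refine le_antisymm ?_ (Finset.le_inf' _ _ fun i _ => hf0 i x)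
    rw [← hi]
    exact Finset.inf'_le (fun i => f i x) (Finset.mem_univ i)
  have hsupp : tsupport θ ⊆ A₀ := by
    refine closure_minimal (fun x hx => ?_) isClosed_closedBall
    contrapose! hx
    rw [Function.notMem_support]
    refine hθf none x (unitClamp_of_nonpos ?_)
    rw [hA₀, mem_closedBall, not_le] at hx
    exact div_nonpos_of_nonpos_of_nonneg (by linarith) hr.le
  have hθΩ : tsupport θ ⊆ Ω := by
    intro x hx
    by_contra hxΩ
    obtain ⟨b, hb, hxb⟩ := mem_iUnion₂.1 (hFcov ⟨hcS (hsupp hx), hxΩ⟩)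
    refine notMem_tsupport_iff_eventuallyEq.2 ?_ hx
    filter_upwards [isOpen_ball.mem_nhds hxb] with y hy
    refine hθf (some ⟨b, hb⟩) y (unitClamp_of_nonpos ?_)
    have := div_lt_iff₀ (hF b hb).1 |>.2 (mem_ball.1 hy)
    simp only
    linarith
  have hθc : HasCompactSupport θ :=
    (isCompact_closedBall c (r₁ + r)).of_isClosed_subset (isClosed_tsupport θ) hsupp
  have hμ : μ (tsupport θ) ≠ ∞ :=
    ne_top_of_le_ne_top (h.measure_lt_top c (r₁ + r) (by linarith)).ne (measure_mono hsupp)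
  have hmain := hHardy.lintegral_inf_cutoff_le hp hΩ hne hδ hH (A := A) (ρ := ρ) (M := M) (e := e)
    (f := f) (θ := θ) (n := n)
    (by rintro (_ | b) <;> exact isClosed_closedBall)
    (by rintro (_ | b); exacts [hr, hFpos b])
    (by rintro (_ | b); exacts [zero_le_one, (inv_pos.2 hH).le])
    (by
      rintro (_ | b) s hs
      · simpa [hM, he] using peak_le_rpow_neg hH hs
      · simpa [hM, he, div_eq_inv_mul] using peak_le_rpow_div hH hs)
    hf0 hf1
    (by
      rintro (_ | b) x y
      · exact abs_unitClamp_sub_div_le c x y hr _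
      · exact abs_unitClamp_div_sub_le _ x y (hFpos b) _)
    (by
      rintro (_ | b) x hx
      · have hx' : x ∈ {y | r₁ + r < dist y c} := by simpa [hA, hA₀] using hx
        have hz : ∀ y, r₁ + r < dist y c → f none y = 0 := fun y hy =>
          unitClamp_of_nonpos (div_nonpos_of_nonpos_of_nonneg (by linarith) hr.le)
        filter_upwards [(isOpen_lt continuous_const (continuous_id.dist continuous_const)).mem_nhds
          hx'] with y hy
        rw [hz y hy, hz x hx']
      · have hb := hFpos b
        have hx' : x ∈ {y | 4 * b.1.2 < dist y b.1.1} := by simpa [hA] using hx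
        have hz : ∀ y, 4 * b.1.2 < dist y b.1.1 → f (some b) y = 1 := fun y hy => by
          refine unitClamp_of_one_le ?_
          have := (lt_div_iff₀ hb).2 hy
          linarith
        filter_upwards [(isOpen_lt continuous_const (continuous_id.dist continuous_const)).mem_nhds
          hx'] with y hy
        rw [hz y hy, hz x hx'])
    (by
      rintro (_ | b) x hx
      · exact hcd x hx
      · obtain ⟨z, hz1, hz2⟩ := (hF b.1 b.2).2.2
        have hb := hFpos b
        have h1 : dist x b.1.1 ≤ 4 * b.1.2 := hx
        have h2 := mem_closedBall'.1 hz1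
        have h3 := infDist_le_dist_of_mem (x := x) hz2.2
        have h4 := dist_triangle x b.1.1 z
        change infDist x Ωᶜ ≤ 6 * b.1.2
        linarith)
    (fun _ => rfl) hθc hθΩ hμ
    (by
      have := abs_nonneg δ
      have hdp : |δ * p| = δ * p := abs_of_nonneg (by positivity)
      rintro (_ | b)
      · have : β + e none * p = β - δ * p := by simp [he]; ring
        rw [this]
        have := abs_sub β (δ * p)
        linarith
      · have : β + e (some b) * p = β + δ * p := by simp [he]
        rw [this]
        have := abs_add_le β (δ * p)
        linarith)
    hτ hτ1 hδC hτC
  have hsum : ∑ i, ENNReal.ofReal ((6 / τ) ^ (n * p) * (M i ^ p * ρ i ^ (β + e i * p - p))) *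
      μ (A i) ≤ ENNReal.ofReal (2 * D * r ^ (-t)) * μ A₀ := by
    rw [Fintype.sum_option]
    have e1 : ENNReal.ofReal ((6 / τ) ^ (n * p) *
        (M none ^ p * ρ none ^ (β + e none * p - p))) * μ (A none) =
        ENNReal.ofReal (D * r ^ (-t)) * μ A₀ := by
      simp only [hM, hρ, he, hA, Option.elim_none, Real.one_rpow, one_mul]
      congr 4
      rw [ht_def]; ring
    have e2 : ∑ b : F, ENNReal.ofReal ((6 / τ) ^ (n * p) *
        (M (some b) ^ p * ρ (some b) ^ (β + e (some b) * p - p))) * μ (A (some b)) =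
        ENNReal.ofReal D * ENNReal.ofReal (H⁻¹ ^ p) * ∑ b ∈ F,
          ENNReal.ofReal (b.2 ^ (-(p - β - δ * p))) * μ (closedBall b.1 (4 * b.2)) := by
      rw [← Finset.sum_coe_sort F, Finset.mul_sum]
      refine Finset.sum_congr rfl fun b _ => ?_
      simp only [hM, hρ, he, hA, Option.elim_some]
      rw [ENNReal.ofReal_mul (by positivity), ENNReal.ofReal_mul (by positivity)]
      rw [show β + δ * p - p = -(p - β - δ * p) by ring]
      ring
    rw [e1, e2]
    calc _ ≤ ENNReal.ofReal (D * r ^ (-t)) * μ A₀ + ENNReal.ofReal D * ENNReal.ofReal (H⁻¹ ^ p) *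
          (ENNReal.ofReal (r ^ (-t)) * μ A₀ / ENNReal.ofReal (H⁻¹ ^ p)) := by gcongr
      _ ≤ ENNReal.ofReal (D * r ^ (-t)) * μ A₀ + ENNReal.ofReal D *
          (ENNReal.ofReal (r ^ (-t)) * μ A₀) := by
          rw [mul_assoc (ENNReal.ofReal D)]
          exact add_le_add_right (mul_le_mul_right ENNReal.mul_div_le _) _
      _ = _ := by
          rw [← mul_assoc, ← ENNReal.ofReal_mul hD.le, ← add_mul,
            ← ENNReal.ofReal_add (by positivity) (by positivity)]
          congr 2
          ring
  set K := {y | a ≤ infDist y Ωᶜ ∧ infDist y Ωᶜ < s} ∩ closedBall c r₁ with hK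
  have hdcont : Continuous fun y => infDist y Ωᶜ := continuous_infDist_pt _
  have hKm : MeasurableSet K :=
    ((isClosed_le continuous_const hdcont).measurableSet.inter
      (isOpen_lt hdcont continuous_const).measurableSet).inter isClosed_closedBall.measurableSet
  have hKΩ : K ⊆ Ω := fun y hy => by
    by_contra hyΩ
    have := infDist_zero_of_mem (s := Ωᶜ) hyΩ
    linarith [hy.1.1]
  have hKθ : ∀ y ∈ K, θ y = 1 := by
    rintro y ⟨⟨hya, -⟩, hyc⟩
    rw [mem_closedBall] at hyc
    refine le_antisymm ((Finset.inf'_le (fun i => f i y) (Finset.mem_univ none)).trans (hf1 _ _))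
      (Finset.le_inf' _ _ ?_)
    rintro (_ | b) -
    · refine (unitClamp_of_one_le ?_).ge
      rw [le_div_iff₀ hr]
      linarith
    · refine (unitClamp_of_one_le ?_).ge
      obtain ⟨-, hb4, z, hz1, hz2⟩ := hF b.1 b.2
      have h2 := mem_closedBall'.1 hz1
      have h3 := infDist_le_dist_of_mem (x := y) hz2.2
      have h4 := dist_triangle y b.1.1 z
      have : 3 ≤ dist y b.1.1 / b.1.2 := by
        rw [le_div_iff₀ (hFpos b)]
        linarith
      linarith
  have hlow : ENNReal.ofReal ((2 ^ p)⁻¹ * s ^ (-t)) * μ K ≤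
      ∫⁻ x in Ω, ENNReal.ofReal ((θ x ^ (n + 1) * peak δ H (infDist x Ωᶜ)) ^ p *
        infDist x Ωᶜ ^ (β - p)) ∂μ := by
    rw [← setLIntegral_const]
    refine (setLIntegral_mono' hKm fun y hy => ENNReal.ofReal_le_ofReal ?_).trans
      (lintegral_mono_set hKΩ)
    rw [hKθ y hy, one_pow, one_mul]
    obtain ⟨⟨hya, hys⟩, -⟩ := hy
    have hd : 0 < infDist y Ωᶜ := ha.trans_le hya
    set d := infDist y Ωᶜ
    have hpk : d ^ (-δ) / 2 ≤ peak δ H d := by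
      refine le_peak hH hd ?_
      rw [hH_def]
      gcongr
    calc (2 ^ p)⁻¹ * s ^ (-t) ≤ (2 ^ p)⁻¹ * d ^ (-t) := by
          gcongr ?_ * ?_
          exact Real.rpow_le_rpow_of_nonpos hd hys.le (by linarith)
      _ = (d ^ (-δ) / 2) ^ p * d ^ (β - p) := by
          rw [Real.div_rpow (by positivity) (by norm_num), ← Real.rpow_mul hd.le,
            show -t = -δ * p + (β - p) by rw [ht_def]; ring, Real.rpow_add hd]
          ring
      _ ≤ _ := by gcongr
  have hall : ENNReal.ofReal ((2 ^ p)⁻¹ * s ^ (-t)) * μ K ≤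
      ENNReal.ofReal (2 * C * (2 ^ p * (n + 1) ^ p) * (2 * D * r ^ (-t))) * μ A₀ := by
    refine hlow.trans (hmain.trans ?_)
    calc _ ≤ 2 * C * ENNReal.ofReal (2 ^ p * (n + 1) ^ p) *
          (ENNReal.ofReal (2 * D * r ^ (-t)) * μ A₀) := by gcongr
      _ = _ := by
          rw [ENNReal.ofReal_mul (p := 2 * C * (2 ^ p * ((n : ℝ) + 1) ^ p)) (by positivity),
            ENNReal.ofReal_mul (p := 2 * C) (by positivity),
            ENNReal.ofReal_mul zero_le_two, ENNReal.ofReal_coe_nnreal, ENNReal.ofReal_ofNat]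
          ring
  calc μ K = ENNReal.ofReal (2 ^ p * s ^ t) * (ENNReal.ofReal ((2 ^ p)⁻¹ * s ^ (-t)) * μ K) := by
        rw [← mul_assoc, ← ENNReal.ofReal_mul (by positivity)]
        have : (2 : ℝ) ^ p * s ^ t * ((2 ^ p)⁻¹ * s ^ (-t)) = 1 := by
          rw [Real.rpow_neg hs.le]
          field_simp
        rw [this, ENNReal.ofReal_one, one_mul]
    _ ≤ ENNReal.ofReal (2 ^ p * s ^ t) *
        (ENNReal.ofReal (2 * C * (2 ^ p * (n + 1) ^ p) * (2 * D * r ^ (-t))) * μ A₀) := by gcongr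
    _ = _ := by
        rw [← mul_assoc, ← ENNReal.ofReal_mul (by positivity)]
        congr 2
        rw [Real.div_rpow hs.le hr.le, Real.rpow_neg hr.le]
        ring

/-- The layers with `a = 1 / (m + 1)` exhaust the part in `Ω`, and their bounds are uniform in `m`.
The remaining part, in `S ∩ Ωᶜ`, is null by the vanishing content. -/
theorem AdmitsHardyWith.measure_thickening_le (hHardy : AdmitsHardyWith μ Ω p β C)
    (h : IsDoublingWith μ C_D) (hp : 1 ≤ p) (hΩ : IsOpen Ω) {δ : ℝ}
    (hδ : 0 ≤ δ) {n : ℕ} (hn : |β| + δ * p ≤ n * p) {τ : ℝ} (hτ : 0 < τ) (hτ1 : τ ≤ 1)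
    (hδC : C * (2 ^ p * δ ^ p) ≤ 1 / 4) (hτC : C * (2 ^ p * ((n + 1) ^ p * τ ^ p)) ≤ 1 / 4)
    (ht : 0 ≤ p - β + δ * p) {S : Set X} (hS : IsCompact S) {q : ℝ}
    (hq : ∀ R : ℝ, 0 < R → hausdorffCocontent μ R q (S ∩ Ωᶜ) = 0) (hqs : p - β - δ * p ≤ q)
    (hqs0 : 0 ≤ p - β - δ * p)
    {c : X} {r₁ r : ℝ} (hr : 0 < r) (hr₁ : 0 ≤ r₁) (hcS : closedBall c (r₁ + r) ⊆ S)
    (hcd : ∀ y ∈ closedBall c (r₁ + r), infDist y Ωᶜ ≤ 6 * r) {E : Set X} (hE : E ⊆ Ωᶜ)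
    {s : ℝ} (hs : 0 < s) :
    μ (thickening s E ∩ closedBall c r₁) ≤
      ENNReal.ofReal (2 ^ p * (2 * C * (2 ^ p * (n + 1) ^ p) * (2 * (6 / τ) ^ (n * p))) *
        (s / r) ^ (p - β + δ * p)) * μ (closedBall c (r₁ + r)) := by
  rcases E.eq_empty_or_nonempty with rfl | hEne
  · simp
  have hne : Ωᶜ.Nonempty := hEne.mono hE
  set U : ℕ → Set X := fun m =>
    {y | ((m : ℝ) + 1)⁻¹ ≤ infDist y Ωᶜ ∧ infDist y Ωᶜ < s} ∩ closedBall c r₁ with hU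
  have hmono : Monotone U := by
    intro m k hmk y hy
    refine ⟨⟨le_trans ?_ hy.1.1, hy.1.2⟩, hy.2⟩
    gcongr
  have hsub : thickening s E ∩ closedBall c r₁ ⊆ (S ∩ Ωᶜ) ∪ ⋃ m, U m := by
    rintro y ⟨hy1, hy2⟩
    by_cases hyΩ : y ∈ Ω
    · right
      have hd : 0 < infDist y Ωᶜ :=
        (hΩ.isClosed_compl.notMem_iff_infDist_pos hne).1 (by simpa using hyΩ)
      obtain ⟨m, hm⟩ := exists_nat_one_div_lt hd
      refine mem_iUnion.2 ⟨m, ⟨?_, ?_⟩, hy2⟩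
      · rw [← one_div]; exact hm.le
      · obtain ⟨z, hz, hyz⟩ := mem_thickening_iff.1 hy1
        exact (infDist_le_dist_of_mem (hE hz)).trans_lt hyz
    · exact Or.inl ⟨hcS (closedBall_subset_closedBall (by linarith) hy2), hyΩ⟩
  have hnull : μ (S ∩ Ωᶜ) = 0 :=
    h.measure_eq_zero_of_hausdorffCocontent (hS.inter_right hΩ.isClosed_compl) hq hqs hqs0
  refine (measure_mono hsub).trans ((measure_union_le _ _).trans ?_)
  rw [hnull, zero_add, hmono.measure_iUnion]
  exact iSup_le fun m => hHardy.measure_layer_le h hp hΩ hne hδ hn hτ hτ1 hδC hτC ht hS hq hqs hr hr₁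
    hcS hcd (by positivity) hs
end

/-! ### The codimension dichotomy. -/

theorem AdmitsHardyWith.le_lcodimA {X : Type*} [MetricSpace X] [CompleteSpace X]
    [MeasurableSpace X] [BorelSpace X] {μ : Measure X} {Ω : Set X} {p β : ℝ} {C_D C : ℝ≥0}
    (hHardy : AdmitsHardyWith μ Ω p β C)
    (h : IsDoublingWith μ C_D) (hp : 1 ≤ p) (hΩ : IsOpen Ω) {δ : ℝ} (hδ : 0 ≤ δ)
    (hδC : C * (2 ^ p * δ ^ p) ≤ 1 / 4) (hqs0 : 0 ≤ p - β - δ * p) {x₀ : X} {R₀ : ℝ}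
    (hR₀ : 0 < R₀) (hcod : ENNReal.ofReal (p - β - δ * p) <
      codimH μ (closedBall x₀ (2 * R₀) ∩ Ωᶜ)) :
    ENNReal.ofReal (p - β + δ * p) ≤ lcodimA μ (closedBall x₀ R₀ ∩ Ωᶜ) := by
  have hX := h.properSpace
  have hp0 : 0 < p := by linarith
  have hδp : 0 ≤ δ * p := by positivity
  have ht : 0 ≤ p - β + δ * p := by linarith
  obtain ⟨n, hn⟩ := exists_nat_ge ((|β| + δ * p) / p)
  rw [div_le_iff₀ hp0] at hn
  obtain ⟨τ, hτ, hτ1, hτC⟩ := exists_pos_mul_rpow_le (K := C * (2 ^ p * ((n : ℝ) + 1) ^ p))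
    (p := p) (by positivity) hp0 one_pos
  rw [mul_assoc, mul_assoc] at hτC
  unfold codimH at hcod
  simp only [lt_iSup_iff] at hcod
  obtain ⟨q, hq, hqlt⟩ := hcod
  have hqs : p - β - δ * p ≤ q := by
    rw [← ENNReal.ofReal_coe_nnreal] at hqlt
    exact (ENNReal.ofReal_le_ofReal_iff (NNReal.coe_nonneg q)).1 hqlt.le
  set E := closedBall x₀ R₀ ∩ Ωᶜ with hE
  set t := p - β + δ * p with ht_def
  set C₁ : ℝ := 2 ^ p * (2 * C * (2 ^ p * (n + 1) ^ p) * (2 * (6 / τ) ^ (n * p))) with hC₁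
  have hC₁0 : 0 ≤ C₁ := by positivity
  have main := fun (c : X) (r₁ r s : ℝ) (hr : 0 < r) (hr₁ : 0 ≤ r₁) hcS hcd (hs : 0 < s) =>
    hHardy.measure_thickening_le h hp hΩ hδ hn hτ hτ1 hδC hτC ht
      (isCompact_closedBall x₀ (2 * R₀)) hq hqs hqs0 (c := c) hr hr₁ hcS hcd (E := E)
      inter_subset_right hs
  simp only [← ht_def, ← hC₁] at main
  -- `Q` compares the scale `R₀ / 2` with any admissible `R`; the `1` in the maximum covers the
  -- single-point convention `R ≤ 1`.
  set Q : ℝ := (max (2 * R₀) 1 / (R₀ / 2)) ^ t with hQ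
  have hQ0 : 0 ≤ Q := by positivity
  unfold lcodimA
  refine le_iSup₂_of_le t.toNNReal ⟨1 + C₁ * C_D + Q + C₁ * C_D ^ 3 * Q, ?_, ?_⟩ le_rfl
  · have : 0 ≤ C₁ * C_D := by positivity
    have : 0 ≤ C₁ * C_D ^ 3 * Q := by positivity
    linarith
  intro x hx r R hr hrR hrange
  rw [Real.coe_toNNReal t ht]
  have hR : 0 < R := hr.trans hrR
  have hrat : 0 ≤ (r / R) ^ t := by positivity
  refine ENNReal.div_le_of_le_mul ?_
  have hxx₀ : dist x x₀ ≤ R₀ := hx.1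
  -- For `2R ≤ R₀` the ball `B(x, 2R)` lies in `2B₀`, and the estimate applies around `x` itself.
  rcases le_or_gt (2 * R) R₀ with hRR | hRR
  · refine (main x R R r hR hR.le ?_ ?_ hr).trans ?_
    · exact closedBall_subset_closedBall' (by linarith)
    · intro y hy
      have h1 := infDist_le_dist_of_mem (x := y) hx.2
      rw [mem_closedBall] at hy
      linarith
    · have h2 := h.doubling x R hR
      rw [two_mul] at h2
      calc _ ≤ ENNReal.ofReal (C₁ * (r / R) ^ t) * (C_D * μ (closedBall x R)) := by gcongr
        _ = ENNReal.ofReal (C₁ * C_D * (r / R) ^ t) * μ (closedBall x R) := by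
            rw [← mul_assoc, ← ENNReal.ofReal_coe_nnreal, ← ENNReal.ofReal_mul (by positivity)]
            congr 2; ring
        _ ≤ _ := by
            gcongr
            have : 0 ≤ C₁ * C_D ^ 3 * Q := by positivity
            linarith
  have hRmax : R ≤ max (2 * R₀) 1 := by
    rcases hrange with hd | ⟨-, h1⟩
    · refine le_max_of_le_left ?_
      have h2 : ediam E ≤ ENNReal.ofReal (2 * R₀) := by
        refine ediam_le fun y hy z hz => ?_
        rw [edist_dist]
        refine ENNReal.ofReal_le_ofReal ?_
        linarith [dist_triangle_right y z x₀, mem_closedBall.1 hy.1, mem_closedBall.1 hz.1]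
      exact (ENNReal.ofReal_le_ofReal_iff (by positivity)).1 (hd.le.trans h2)
    · exact le_max_of_le_right h1
  -- For large `R`, either `r` is comparable to `R` and the bound is trivial, or the neighbourhood
  -- lies in `B(x₀, 3R₀/2)` and the estimate applies there.
  rcases le_or_gt (R₀ / 2) r with hrR₀ | hrR₀
  · have h1 : 1 ≤ Q * (r / R) ^ t := by
      rw [hQ, ← Real.mul_rpow (by positivity) (by positivity)]
      refine Real.one_le_rpow ?_ ht
      rw [div_mul_div_comm, le_div_iff₀ (by positivity), one_mul, mul_comm]
      gcongr
    calc _ ≤ 1 * μ (closedBall x R) := by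
          rw [one_mul]; exact measure_mono inter_subset_right
      _ ≤ _ := by
          gcongr
          rw [ENNReal.one_le_ofReal]
          refine h1.trans ?_
          gcongr
          have : 0 ≤ C₁ * C_D ^ 3 * Q := by positivity
          have : 0 ≤ C₁ * C_D := by positivity
          linarith
  · have hsub : thickening r E ∩ closedBall x R ⊆
        thickening r E ∩ closedBall x₀ (3 / 2 * R₀) := by
      rintro y ⟨hy, -⟩
      refine ⟨hy, ?_⟩
      obtain ⟨z, hz, hyz⟩ := mem_thickening_iff.1 hy
      have h1 : dist z x₀ ≤ R₀ := hz.1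
      rw [mem_closedBall]
      linarith [dist_triangle y z x₀]
    have e2 : 3 / 2 * R₀ + R₀ / 2 = 2 * R₀ := by ring
    refine (measure_mono hsub).trans ((main x₀ (3 / 2 * R₀) (R₀ / 2) r (by positivity)
      (by positivity) (by rw [e2]) ?_ hr).trans ?_)
    -- Points of `2B₀` are within `3R₀ = 6 (R₀ / 2)` of `x`; this is the case that requires the
    -- constant `6`.
    · intro y hy
      rw [e2, mem_closedBall] at hy
      have h1 := infDist_le_dist_of_mem (x := y) hx.2
      linarith [dist_triangle_right y x x₀]
    · have h3 : μ (closedBall x₀ (3 / 2 * R₀ + R₀ / 2)) ≤ C_D ^ 3 * μ (closedBall x R) := by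
        calc _ ≤ μ (closedBall x (2 ^ 3 * (R₀ / 2))) := by
              refine measure_mono (closedBall_subset_closedBall' ?_)
              rw [dist_comm]; linarith
          _ ≤ C_D ^ 3 * μ (closedBall x (R₀ / 2)) :=
              h.measure_closedBall_two_pow_mul_le x (by positivity) 3
          _ ≤ _ := by
              gcongr
              linarith
      have h4 : (r / (R₀ / 2)) ^ t ≤ Q * (r / R) ^ t := by
        rw [hQ, ← Real.mul_rpow (by positivity) (by positivity)]
        refine Real.rpow_le_rpow (by positivity) ?_ ht
        calc r / (R₀ / 2) = R / (R₀ / 2) * (r / R) := by field_simp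
          _ ≤ _ := by gcongr
      calc _ ≤ ENNReal.ofReal (C₁ * (Q * (r / R) ^ t)) * (C_D ^ 3 * μ (closedBall x R)) := by
            gcongr
        _ = ENNReal.ofReal (C₁ * C_D ^ 3 * Q * (r / R) ^ t) * μ (closedBall x R) := by
            rw [← mul_assoc, ← ENNReal.ofReal_coe_nnreal, ← ENNReal.ofReal_pow (by positivity),
              ← ENNReal.ofReal_mul (by positivity)]
            congr 2; ring
        _ ≤ _ := by
            gcongr
            have : 0 ≤ C₁ * C_D := by positivity
            linarith

end

theorem theorem6p2 (p β : ℝ) (hp : 1 ≤ p) (hβ : β ≠ p) (C_D C_H : ℝ≥0) :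
    ∃ ε : ℝ, 0 < ε ∧
      ∀ (X : Type*) [MetricSpace X] [CompleteSpace X] [MeasurableSpace X] [BorelSpace X]
        (μ : Measure X), IsDoublingWith μ C_D →
      ∀ Ω : Set X, IsOpen Ω → AdmitsHardyWith μ Ω p β C_H →
      ∀ (x₀ : X) (R₀ : ℝ), 0 < R₀ →
        ((codimH μ (closedBall x₀ (2 * R₀) ∩ Ωᶜ) : EReal) < ((p - β - ε : ℝ) : EReal) ∨
          ((p - β + ε : ℝ) : EReal) < (lcodimA μ (closedBall x₀ R₀ ∩ Ωᶜ) : EReal)) := by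
  have hp0 : 0 < p := by linarith
  rcases lt_or_gt_of_ne hβ with hlt | hgt
  · obtain ⟨δ, hδ, hδm, hδC⟩ := exists_pos_mul_rpow_le (K := C_H * 2 ^ p) (p := p)
      (m := (p - β) / (2 * p)) (by positivity) hp0 (div_pos (by linarith) (by positivity))
    rw [mul_assoc] at hδC
    rw [le_div_iff₀ (by positivity)] at hδm
    have hδp : 0 < δ * p := by positivity
    -- Half of the gain `δ p` makes both comparisons strict, and `2 δ p ≤ p - β` keeps `p - β - δ p`
    -- nonnegative.
    refine ⟨δ * p / 2, by positivity, ?_⟩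
    intro X _ _ _ _ μ h Ω hΩ hHardy x₀ R₀ hR₀
    refine or_iff_not_imp_left.2 fun hcod => ?_
    rw [not_lt] at hcod
    have h1 : ENNReal.ofReal (p - β - δ * p) < codimH μ (closedBall x₀ (2 * R₀) ∩ Ωᶜ) := by
      rw [← EReal.coe_ennreal_lt_coe_ennreal_iff, EReal.coe_ennreal_ofReal,
        max_eq_left (by linarith)]
      refine lt_of_lt_of_le ?_ hcod
      rw [EReal.coe_lt_coe_iff]
      linarith
    have h2 := hHardy.le_lcodimA h hp hΩ hδ.le hδC (by linarith) hR₀ h1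
    rw [← EReal.coe_ennreal_le_coe_ennreal_iff, EReal.coe_ennreal_ofReal,
      max_eq_left (by linarith)] at h2
    refine lt_of_lt_of_le ?_ h2
    rw [EReal.coe_lt_coe_iff]
    linarith
  -- For `β > p` the bound `p - β + ε = (p - β) / 2` is negative and codimensions are nonnegative.
  · refine ⟨(β - p) / 2, by linarith, ?_⟩
    intro X _ _ _ _ μ h Ω hΩ hHardy x₀ R₀ hR₀
    refine Or.inr (lt_of_lt_of_le ?_ (EReal.coe_ennreal_nonneg _))
    rw [← EReal.coe_zero, EReal.coe_lt_coe_iff]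
    linarith
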